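/- **Setting.** A repeater chain has nodes $0,1,\dots,K$ with $K=2^i$, $i\ge 0$, and a quantum channel (link) between nodes $n-1$ and $n$ for $1\le n\le K$. At each of its two ends every link has $B\ge 1$ memories ($2B$ memories per interior node); a stored entangled pair between nodes $a<b$ occupies one of the memories of $a$ for the link on its right and one of the memories of $b$ for the link on its left. In the cognitive memory allocation method, on each link pairs of neighbouring nodes are generated at the events of a Poisson process of rate $p>0$, independently for different links, whenever a memory for this link is free at both ends (stored pairs of higher level are never displaced). A pair between nodes $m2^j$ and $(m+1)2^j$ has level $j$. Swaps follow the doubling method: as soon as there are a pair between $2m2^j$ and $(2m+1)2^j$ and a pair between $(2m+1)2^j$ and $(2m+2)2^j$, they are consumed, and with probability $q\in(0,1]$, independently of everything else, they are replaced by a level $j+1$ pair between $2m2^j$ and $(2m+2)2^j$, which uses the memories of the consumed pairs at these two nodes; otherwise nothing is obtained. Swaps and classical communication take no time. Pairs between nodes $0$ and $K$ are delivered to the end users as soon as they are created and are not stored. Let $E(p,q,B,i)$ be the entanglement distribution rate: the limit, as $t\to\infty$, of $1/t$ times the expected number of pairs between nodes $0$ and $K$ created in $[0,t]$, starting with no stored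 pairs. **Theorem.** The rate $E(p,q,B,i)$ exists. Define $f_{b,i}$ for $b\ge 1$, $i\ge 0$ by $f_{b,0}=1$ and $$\frac{f_{b,i}}{f_{b,i-1}} = 1-\Bigl[1+2\sum_{j=0}^{b-1}\frac{\prod_{j_0=0}^{j} f_{b-j_0,\,i-1}}{(f_{b,i-1})^{j+1}}\Bigr]^{-1}\qquad(i\ge 1),$$ so that $f_{b,1}=2b/(2b+1)$. Then for all $p>0$, $B\ge 1$, $i\ge 0$ the following limit exists and satisfies $$\lim_{q\downarrow 0}\frac{E(p,q,B,i)}{p\,q^i f_{B,i}}\ \ge\ 1 .$$ The same holds if the recursion is started instead with $f_{b,0}=2b/(2b+1)$. In the special case $B=1$, $p\,q^i f_{1,i}=p\,(2q/3)^i$ (with $f_{1,0}=1$). -/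

import Mathlib

open Filter Topology

/-- The state of a chain of `2 ^ n` links with `B` memories per link, for the doubling method.
A chain of `2 ^ (n + 1)` links consists of its left and right halves; its state is
`(L, R, eL, eR)`, where `L`, `R` are the states of the two halves and `eL`, `eR` are the numbers of
stored level `n` pairs that span exactly the left half and exactly the right half.
(A pair spanning the whole chain is not part of the state of the chain itself.) -/
def ChainState (B : ℕ) : ℕ → Type
  | 0 => Unit
  | n + 1 => ChainState B n × ChainState B n × Fin (B + 1) × Fin (B + 1)

instance ChainState.instDecidableEq (B : ℕ) : (n : ℕ) → DecidableEq (ChainState B n)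
  | 0 => inferInstanceAs (DecidableEq Unit)
  | n + 1 =>
    haveI := ChainState.instDecidableEq B n
    inferInstanceAs (DecidableEq (ChainState B n × ChainState B n × Fin (B + 1) × Fin (B + 1)))

instance ChainState.instFintype (B : ℕ) : (n : ℕ) → Fintype (ChainState B n)
  | 0 => inferInstanceAs (Fintype Unit)
  | n + 1 =>
    haveI := ChainState.instFintype B n
    inferInstanceAs (Fintype (ChainState B n × ChainState B n × Fin (B + 1) × Fin (B + 1)))

/-- The state in which no pair is stored. -/
def ChainState.empty (B : ℕ) : (n : ℕ) → ChainState B n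
  | 0 => ()
  | n + 1 => (ChainState.empty B n, ChainState.empty B n, 0, 0)

/-- One more stored pair. The truncation at `B` is never active in a state that can be reached from
the empty one: a new pair takes over memories that were already counted among the `B` memories of
the bank, or that were checked to be free. -/
def storePair {B : ℕ} (e : Fin (B + 1)) : Fin (B + 1) :=
  ⟨min ((e : ℕ) + 1) B, by omega⟩

/-- One stored pair less. -/
def removePair {B : ℕ} (e : Fin (B + 1)) : Fin (B + 1) :=
  ⟨(e : ℕ) - 1, by omega⟩

/-- The effect of one successful channel event ("a level 0 pair could now be generated") on link
number `l` (links are numbered `0, …, 2 ^ n - 1` from left to right) of a chain of `2 ^ n` links.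
The returned Boolean says whether a pair spanning the whole chain has been created.

* `coin j` is the outcome (success or failure) of the swap of two level `j` pairs, if there is one;
* `u` is the number of pairs that have their left end at the leftmost node of the chain and are not
  recorded in the state of the chain (they span a larger stretch, or exactly this chain); each of
  them occupies one of the `B` memories which that node has for the link on its right;
* `v` is the same for the right ends at the rightmost node and the link on its left.

A single link generates a pair if and only if there is a free memory for this link at both of its
ends. A pair that spans one half of a chain is swapped at the middle node at once if a pair that
spans the other half is stored, and is stored otherwise. A swap consumes both pairs; if it succeeds,
a pair spanning the chain is created, which uses the memories of the two consumed pairs at the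
two ends of the chain, and otherwise nothing is created. Stored pairs of higher level are never
displaced by pairs of lower level. -/
def chainStep (B : ℕ) : (n : ℕ) → (coin : Fin n → Bool) → (l u v : ℕ) → ChainState B n →
    ChainState B n × Bool
  | 0, _, _, u, v, s => (s, decide (u < B ∧ v < B))
  | n + 1, coin, l, u, v, (L, R, eL, eR) =>
    if l < 2 ^ n then
      let r := chainStep B n (fun j => coin j.castSucc) l (u + eL) eL L
      if r.2 = true then
        if eR = 0 then ((r.1, R, storePair eL, eR), false)
        else ((r.1, R, eL, removePair eR), coin (Fin.last n))
      else ((r.1, R, eL, eR), false)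
    else
      let r := chainStep B n (fun j => coin j.castSucc) (l - 2 ^ n) eR (v + eR) R
      if r.2 = true then
        if eL = 0 then ((L, r.1, eL, storePair eR), false)
        else ((L, r.1, removePair eL, eR), coin (Fin.last n))
      else ((L, r.1, eL, eR), false)

/-- The probability of the swap outcomes `coin`: independent, each successful with
probability `q`. -/
noncomputable def coinProb (q : ℝ) {n : ℕ} (coin : Fin n → Bool) : ℝ :=
  ∏ j, if coin j = true then q else 1 - q

/-- The generator (matrix of transition rates, rows summing to zero) of the continuous-time Markov
chain of the cognitive method on `2 ^ n` links with `B` memories per link: the channel events of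
each link form a Poisson process of rate `p`, independently of each other and of the swap
outcomes. Pairs that span the whole chain are handed to the end users and not stored. -/
noncomputable def cognitiveGenerator (p q : ℝ) (B n : ℕ) :
    Matrix (ChainState B n) (ChainState B n) ℝ :=
  Matrix.of fun s s' => p * ∑ l ∈ Finset.range (2 ^ n), ∑ coin : Fin n → Bool,
    coinProb q coin *
      ((if (chainStep B n coin l 0 0 s).1 = s' then 1 else 0) - (if s = s' then 1 else 0))

/-- The rate at which, in state `s`, pairs spanning the whole chain are created. -/
noncomputable def deliveryIntensity (p q : ℝ) (B n : ℕ) (s : ChainState B n) : ℝ :=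
  p * ∑ l ∈ Finset.range (2 ^ n), ∑ coin : Fin n → Bool,
    coinProb q coin * (if (chainStep B n coin l 0 0 s).2 = true then 1 else 0)

/-- The expected number of pairs between the two end nodes created during `[0, t]` when no pair is
stored at time `0`; the transition matrix over a time `τ` is `exp (τ • generator)`. -/
noncomputable def expectedDeliveries (p q : ℝ) (B n : ℕ) (t : ℝ) : ℝ :=
  ∫ τ in (0 : ℝ)..t, ∑ s : ChainState B n,
    (NormedSpace.exp (τ • cognitiveGenerator p q B n)) (ChainState.empty B n) s *
      deliveryIntensity p q B n s

/-- `E` is the entanglement distribution rate of the cognitive method: the long-run average number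
per unit of time of pairs created between the two end nodes of a chain of `2 ^ n` links. -/
def IsDistributionRate (p q : ℝ) (B n : ℕ) (E : ℝ) : Prop :=
  Tendsto (fun t : ℝ => expectedDeliveries p q B n t / t) atTop (𝓝 E)

/-- The coefficients `f_{b,i}` (`rateCoeff f₀ i b`) given by the recursion with `f_{b,0} = f₀ b`. -/
noncomputable def rateCoeff (f₀ : ℕ → ℝ) : ℕ → ℕ → ℝ
  | 0, b => f₀ b
  | i + 1, b => rateCoeff f₀ i b *
      (1 - (1 + 2 * ∑ j ∈ Finset.range b,
        (∏ j₀ ∈ Finset.range (j + 1), rateCoeff f₀ i (b - j₀)) / rateCoeff f₀ i b ^ (j + 1))⁻¹)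

/-! For small `q` the levels separate in time. Suppose a half of `2 ^ n` links, with `u` and `v`
memories blocked at its two ends, creates spanning pairs at rate about `q ^ n * R u v`. In the
doubled chain no swap is ever pending, so `X = eL - eR` records both counts; on the time scale `q ^
(-n)` it is a birth and death chain with birth rate `R (u + X⁺) X⁺` and death rate `R X⁻ (v + X⁻)`.
In equilibrium the swap rate equals its mean birth rate `T u v`, so the doubled chain creates pairs
at rate about `q ^ (n + 1) * T u v`. Iterating, the limit of `E / (p q ^ n)` is exactly `R 0 0` for
the table of level `n`.

The recursion for `f` is the throughput of the symmetric chain with rates `f (b - X⁺)` and `f (b -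
X⁻)`. With `b` memories free at both ends the true rates are at least these, because tables decrease
in `u` and `v`. The inequality then follows from monotonicity of the throughput in the rates
(`IsBalanced.le`). This needs the marginal value `ψ X` of a left pair to lie in `[0, 1]`; it does
because birth rates decrease and death rates increase in `X`. Here `ψ X = 1_{X < 0} + φ (X + 1) - φ
X`, where `φ` solves the Poisson equation for the swap rate.

Time scale separation is made rigorous without stationary laws. `HasRate` asks for a corrector `h`
whose drift bounds the creation rate up to a higher order error, and `HasRate.succ` builds the
corrector of a chain from those of its halves and `φ`. The mean ergodic theorem for finite chains
gives existence of the rate, and `Matrix.average_le` turns correctors into bounds on it. -/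

/-! ### Admissible states -/

/-- The states in which no bank holds more than `B` pairs, when `u` and `v` memories are occupied
by further pairs at the two ends, and in which no swap is pending. -/
def ChainState.Admissible {B : ℕ} : (n : ℕ) → (u v : ℕ) → ChainState B n → Prop
  | 0, u, v, _ => u ≤ B ∧ v ≤ B
  | n + 1, u, v, (L, R, eL, eR) => (eL = 0 ∨ eR = 0) ∧
      ChainState.Admissible n (u + eL) eL L ∧ ChainState.Admissible n eR (v + eR) R

theorem ChainState.Admissible.anti {B : ℕ} : ∀ {n : ℕ} {u v u' v' : ℕ} {s : ChainState B n},
    s.Admissible n u v → u' ≤ u → v' ≤ v → s.Admissible n u' v'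
  | 0, _, _, _, _, _, h, hu, hv => ⟨hu.trans h.1, hv.trans h.2⟩
  | _ + 1, _, _, _, _, (_, _, _, _), h, hu, hv =>
    ⟨h.1, h.2.1.anti (by omega) le_rfl, h.2.2.anti le_rfl (by omega)⟩

theorem ChainState.Admissible.le {B : ℕ} : ∀ {n : ℕ} {u v : ℕ} {s : ChainState B n},
    s.Admissible n u v → u ≤ B ∧ v ≤ B
  | 0, _, _, _, h => h
  | _ + 1, _, _, (_, _, _, _), h => ⟨by have := h.2.1.le; omega, by have := h.2.2.le; omega⟩

theorem ChainState.admissible_empty (B : ℕ) : ∀ n : ℕ, (ChainState.empty B n).Admissible n 0 0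
  | 0 => ⟨Nat.zero_le _, Nat.zero_le _⟩
  | n + 1 => ⟨Or.inl rfl, by simpa using ChainState.admissible_empty B n,
      by simpa using ChainState.admissible_empty B n⟩

theorem storePair_val {B : ℕ} {e : Fin (B + 1)} (h : (e : ℕ) + 1 ≤ B) :
    (storePair e : ℕ) = e + 1 := by
  simp [storePair, h]

theorem removePair_val {B : ℕ} (e : Fin (B + 1)) : (removePair e : ℕ) = e - 1 := rfl

/-- The first claim is what carries the induction: a new spanning pair either came from links with
free memories at both ends or inherits memories already counted, so there is room to store it one
level up. Hence `storePair` never truncates. -/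
theorem ChainState.Admissible.chainStep {B : ℕ} : ∀ {n : ℕ} (coin : Fin n → Bool) (l : ℕ) {u v : ℕ}
    {s : ChainState B n}, s.Admissible n u v →
    ((chainStep B n coin l u v s).2 = true →
      (chainStep B n coin l u v s).1.Admissible n (u + 1) (v + 1)) ∧
    (chainStep B n coin l u v s).1.Admissible n u v
  | 0, _, _, u, v, s, h => by
    refine ⟨fun h' => ?_, h⟩
    simp only [_root_.chainStep, decide_eq_true_eq] at h'
    exact ⟨h'.1, h'.2⟩
  | n + 1, coin, l, u, v, (L, R, eL, eR), h => by
    obtain ⟨h0, hL, hR⟩ := h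
    by_cases hl : l < 2 ^ n
    · obtain ⟨i1, i2⟩ := ChainState.Admissible.chainStep (fun j => coin j.castSucc) l hL
      simp only [_root_.chainStep, hl, if_true]
      split_ifs with hr hR0
      · have i := i1 hr
        have := i.le
        refine ⟨fun h' => by simp at h', Or.inr hR0, ?_, hR⟩
        rw [storePair_val this.2]
        exact i
      · have i := i1 hr
        have h0' : eL = 0 := by tauto
        have hpos : 0 < (eR : ℕ) := Nat.pos_of_ne_zero fun h => hR0 (Fin.ext h)
        refine ⟨fun _ => ⟨Or.inl h0', ?_, ?_⟩, ⟨Or.inl h0', i2, ?_⟩⟩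
        · exact i.anti (by omega) (by omega)
        · rw [removePair_val]
          exact hR.anti (by omega) (by omega)
        · rw [removePair_val]
          exact hR.anti (by omega) (by omega)
      · exact ⟨fun h' => by simp at h', h0, i2, hR⟩
    · obtain ⟨i1, i2⟩ := ChainState.Admissible.chainStep (fun j => coin j.castSucc) (l - 2 ^ n) hR
      simp only [_root_.chainStep, hl, if_false]
      split_ifs with hr hL0
      · have i := i1 hr
        have := i.le
        refine ⟨fun h' => by simp at h', Or.inl hL0, hL, ?_⟩
        rw [storePair_val this.1]
        exact i
      · have i := i1 hr
        have h0' : eR = 0 := by tauto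
        have hpos : 0 < (eL : ℕ) := Nat.pos_of_ne_zero fun h => hL0 (Fin.ext h)
        refine ⟨fun _ => ⟨Or.inr h0', ?_, ?_⟩, ⟨Or.inr h0', ?_, i2⟩⟩
        · rw [removePair_val]
          exact hL.anti (by omega) (by omega)
        · exact i.anti (by omega) (by omega)
        · rw [removePair_val]
          exact hL.anti (by omega) (by omega)
      · exact ⟨fun h' => by simp at h', h0, hL, i2⟩

/-! ### Channel events: creation rate and drift -/

/-- The sum over all links of the expected value of `F (new state) (pair created?)` after a
channel event on this link. -/
noncomputable def eventSum (q : ℝ) {B n : ℕ} (u v : ℕ) (F : ChainState B n → Bool → ℝ)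
    (s : ChainState B n) : ℝ :=
  ∑ l ∈ Finset.range (2 ^ n), ∑ coin : Fin n → Bool,
    coinProb q coin * F (chainStep B n coin l u v s).1 (chainStep B n coin l u v s).2

theorem coinProb_nonneg {q : ℝ} (h0 : 0 ≤ q) (h1 : q ≤ 1) {n : ℕ} (coin : Fin n → Bool) :
    0 ≤ coinProb q coin :=
  Finset.prod_nonneg fun j _ => by split_ifs <;> linarith

theorem sum_coin_succ (q : ℝ) {n : ℕ} (F : (Fin n → Bool) → Bool → ℝ) :
    ∑ coin : Fin (n + 1) → Bool,
      coinProb q coin * F (fun j => coin j.castSucc) (coin (Fin.last n)) =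
    ∑ coin : Fin n → Bool, coinProb q coin * (q * F coin true + (1 - q) * F coin false) := by
  rw [← (Fin.snocEquiv fun _ => Bool).sum_comp, Fintype.sum_prod_type_right]
  refine Finset.sum_congr rfl fun c _ => ?_
  simp only [Fintype.sum_bool, coinProb, Fin.prod_univ_castSucc, Fin.snocEquiv_apply,
    Fin.snoc_castSucc, Fin.snoc_last]
  simp
  ring

theorem sum_coinProb (q : ℝ) : ∀ n : ℕ, ∑ coin : Fin n → Bool, coinProb q coin = 1
  | 0 => by simp [coinProb]
  | n + 1 => by
    have := sum_coin_succ q (n := n) fun _ _ => 1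
    simp only [mul_one, add_sub_cancel] at this
    rw [this, sum_coinProb q n]

theorem eventSum_zero (q : ℝ) {B : ℕ} (u v : ℕ) (F : ChainState B 0 → Bool → ℝ)
    (s : ChainState B 0) : eventSum q u v F s = F s (decide (u < B ∧ v < B)) := by
  simp [eventSum, coinProb, chainStep]

/-- The left half sees `u + eL` blocked memories at its outer end and `eL` at the middle node,
symmetrically for the right half. The coin of the top swap is averaged out here, so only the coins
of the halves remain. -/
theorem eventSum_succ (q : ℝ) {B n : ℕ} (u v : ℕ) (F : ChainState B (n + 1) → Bool → ℝ)
    (L R : ChainState B n) (eL eR : Fin (B + 1)) :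
    eventSum (n := n + 1) q u v F (L, R, eL, eR) =
      eventSum q (u + eL) eL (fun L' b =>
        if b = true then
          if eR = 0 then F (L', R, storePair eL, eR) false
          else q * F (L', R, eL, removePair eR) true + (1 - q) * F (L', R, eL, removePair eR) false
        else F (L', R, eL, eR) false) L +
      eventSum q eR (v + eR) (fun R' b =>
        if b = true then
          if eL = 0 then F (L, R', eL, storePair eR) false
          else q * F (L, R', removePair eL, eR) true + (1 - q) * F (L, R', removePair eL, eR) false
        else F (L, R', eL, eR) false) R := by
  unfold eventSum
  rw [pow_succ, mul_two, Finset.sum_range_add]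
  congr 1
  · refine Finset.sum_congr rfl fun l hl => ?_
    rw [Finset.mem_range] at hl
    refine Eq.trans ?_ ((sum_coin_succ q (n := n) fun c b =>
      let r := chainStep B n c l (u + eL) eL L
      let t : ChainState B (n + 1) × Bool :=
        if r.2 = true then
          if eR = 0 then ((r.1, R, storePair eL, eR), false)
          else ((r.1, R, eL, removePair eR), b)
        else ((r.1, R, eL, eR), false)
      F t.1 t.2).trans ?_)
    · refine Finset.sum_congr rfl fun c _ => ?_
      simp only [chainStep, hl, if_true]
    · refine Finset.sum_congr rfl fun c _ => ?_
      congr 1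
      dsimp only
      split_ifs <;> simp <;> ring
  · refine Finset.sum_congr rfl fun l _ => ?_
    have hl : ¬ (2 ^ n + l < 2 ^ n) := by omega
    refine Eq.trans ?_ ((sum_coin_succ q (n := n) fun c b =>
      let r := chainStep B n c l eR (v + eR) R
      let t : ChainState B (n + 1) × Bool :=
        if r.2 = true then
          if eL = 0 then ((L, r.1, eL, storePair eR), false)
          else ((L, r.1, removePair eL, eR), b)
        else ((L, r.1, eL, eR), false)
      F t.1 t.2).trans ?_)
    · refine Finset.sum_congr rfl fun c _ => ?_
      simp only [chainStep, hl, if_false, Nat.add_sub_cancel_left]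
    · refine Finset.sum_congr rfl fun c _ => ?_
      congr 1
      dsimp only
      split_ifs <;> simp <;> ring

theorem eventSum_add (q : ℝ) {B n : ℕ} (u v : ℕ) (F F' : ChainState B n → Bool → ℝ)
    (s : ChainState B n) :
    eventSum q u v (fun s' b => F s' b + F' s' b) s = eventSum q u v F s + eventSum q u v F' s := by
  simp only [eventSum, mul_add, Finset.sum_add_distrib]

theorem eventSum_const_mul (q : ℝ) {B n : ℕ} (u v : ℕ) (c : ℝ) (F : ChainState B n → Bool → ℝ)
    (s : ChainState B n) :
    eventSum q u v (fun s' b => c * F s' b) s = c * eventSum q u v F s := by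
  simp only [eventSum, Finset.mul_sum]
  exact Finset.sum_congr rfl fun _ _ => Finset.sum_congr rfl fun _ _ => by ring

theorem eventSum_const (q : ℝ) {B n : ℕ} (u v : ℕ) (c : ℝ) (s : ChainState B n) :
    eventSum q u v (fun _ _ => c) s = 2 ^ n * c := by
  simp [eventSum, ← Finset.sum_mul, sum_coinProb]

theorem eventSum_le {q : ℝ} (h0 : 0 ≤ q) (h1 : q ≤ 1) {B n : ℕ} (u v : ℕ)
    {F F' : ChainState B n → Bool → ℝ} (s : ChainState B n) (h : ∀ s' b, F s' b ≤ F' s' b) :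
    eventSum q u v F s ≤ eventSum q u v F' s :=
  Finset.sum_le_sum fun _ _ => Finset.sum_le_sum fun _ _ =>
    mul_le_mul_of_nonneg_left (h _ _) (coinProb_nonneg h0 h1 _)

theorem eventSum_nonneg {q : ℝ} (h0 : 0 ≤ q) (h1 : q ≤ 1) {B n : ℕ} {u v : ℕ}
    {F : ChainState B n → Bool → ℝ} {s : ChainState B n} (hs : s.Admissible n u v)
    (h : ∀ s' b, s'.Admissible n u v → 0 ≤ F s' b) :
    0 ≤ eventSum q u v F s :=
  Finset.sum_nonneg fun _ _ => Finset.sum_nonneg fun _ _ =>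
    mul_nonneg (coinProb_nonneg h0 h1 _) (h _ _ (hs.chainStep _ _).2)

theorem eventSum_congr (q : ℝ) {B n : ℕ} {u v : ℕ}
    {F F' : ChainState B n → Bool → ℝ} {s : ChainState B n} (hs : s.Admissible n u v)
    (h : ∀ s' b, (b = true → s'.Admissible n (u + 1) (v + 1)) → F s' b = F' s' b) :
    eventSum q u v F s = eventSum q u v F' s :=
  Finset.sum_congr rfl fun _ _ => Finset.sum_congr rfl fun _ _ => by
    rw [h _ _ (hs.chainStep _ _).1]

/-- The total probability, summed over the links, that a channel event creates a pair that spans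
the chain. -/
noncomputable def creation (q : ℝ) {B n : ℕ} (u v : ℕ) (s : ChainState B n) : ℝ :=
  eventSum q u v (fun _ b => if b = true then 1 else 0) s

/-- The generator, for channel events of rate one, applied to a function `h` of the state. -/
noncomputable def drift (q : ℝ) {B n : ℕ} (u v : ℕ) (h : ChainState B n → ℝ)
    (s : ChainState B n) : ℝ :=
  eventSum q u v (fun s' _ => h s' - h s) s

theorem creation_nonneg {q : ℝ} (h0 : 0 ≤ q) (h1 : q ≤ 1) {B n : ℕ} (u v : ℕ)
    (s : ChainState B n) : 0 ≤ creation q u v s := by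
  unfold creation eventSum
  exact Finset.sum_nonneg fun _ _ => Finset.sum_nonneg fun _ _ =>
    mul_nonneg (coinProb_nonneg h0 h1 _) (by dsimp only; split_ifs <;> norm_num)

theorem drift_add (q : ℝ) {B n : ℕ} (u v : ℕ) (h h' : ChainState B n → ℝ) (s : ChainState B n) :
    drift q u v (fun s => h s + h' s) s = drift q u v h s + drift q u v h' s := by
  rw [drift, drift, drift, ← eventSum_add]
  congr 1
  funext s' _
  ring

theorem drift_const_mul (q : ℝ) {B n : ℕ} (u v : ℕ) (c : ℝ) (h : ChainState B n → ℝ)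
    (s : ChainState B n) :
    drift q u v (fun s => c * h s) s = c * drift q u v h s := by
  rw [drift, drift, ← eventSum_const_mul]
  congr 1
  funext s' _
  ring

theorem creation_succ (q : ℝ) {B n : ℕ} (u v : ℕ)
    (L R : ChainState B n) (eL eR : Fin (B + 1)) :
    creation (n := n + 1) q u v (L, R, eL, eR) =
      q * (if eR = 0 then 0 else 1) * creation q (u + eL) eL L +
      q * (if eL = 0 then 0 else 1) * creation q eR (v + eR) R := by
  simp only [creation]
  rw [eventSum_succ, ← eventSum_const_mul, ← eventSum_const_mul]
  congr 2 <;> funext s' b <;> split_ifs <;> simp_all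

/-- The drift of a function of the state of one half, with the other coordinates entering as
parameters, up to what happens at creations. -/
theorem le_drift_succ {q : ℝ} (h0 : 0 ≤ q) (h1 : q ≤ 1) {B n : ℕ} (u v : ℕ)
    (α β : Fin (B + 1) → Fin (B + 1) → ChainState B n → ℝ) {M : ℝ}
    (hα : ∀ a b s, |α a b s| ≤ M) (hβ : ∀ a b s, |β a b s| ≤ M)
    (L R : ChainState B n) (eL eR : Fin (B + 1)) :
    drift q (u + eL) eL (α eL eR) L + drift q eR (v + eR) (β eL eR) R
      - 4 * M * (creation q (u + eL) eL L + creation q eR (v + eR) R) ≤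
    drift (n := n + 1) q u v (fun s => α s.2.2.1 s.2.2.2 s.1 + β s.2.2.1 s.2.2.2 s.2.1)
      (L, R, eL, eR) := by
  simp only [abs_le] at hα hβ
  -- A creation changes the parameters of both `α` and `β`, each by at most `2 * M` in value; this
  -- is the `4 * M` charged per creation.
  have e1 : drift q (u + eL) eL (α eL eR) L - 4 * M * creation q (u + eL) eL L =
      eventSum q (u + eL) eL (fun s' b => α eL eR s' - α eL eR L +
        (-(4 * M)) * (if b = true then 1 else 0)) L := by
    rw [eventSum_add, eventSum_const_mul, drift, creation]
    ring
  have e2 : drift q eR (v + eR) (β eL eR) R - 4 * M * creation q eR (v + eR) R =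
      eventSum q eR (v + eR) (fun s' b => β eL eR s' - β eL eR R +
        (-(4 * M)) * (if b = true then 1 else 0)) R := by
    rw [eventSum_add, eventSum_const_mul, drift, creation]
    ring
  have key : drift q (u + eL) eL (α eL eR) L - 4 * M * creation q (u + eL) eL L +
      (drift q eR (v + eR) (β eL eR) R - 4 * M * creation q eR (v + eR) R) ≤
      drift (n := n + 1) q u v (fun s => α s.2.2.1 s.2.2.2 s.1 + β s.2.2.1 s.2.2.2 s.2.1)
      (L, R, eL, eR) := by
    rw [e1, e2]
    refine le_of_le_of_eq ?_ (eventSum_succ q u v _ L R eL eR).symm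
    refine add_le_add (eventSum_le h0 h1 _ _ _ fun s' b => ?_)
      (eventSum_le h0 h1 _ _ _ fun s' b => ?_)
    · have a1 := hα eL eR s'
      have a2 := hα eL eR L
      have a3 := hβ eL eR R
      split_ifs
      · have a4 := hα (storePair eL) eR s'
        have a5 := hβ (storePair eL) eR R
        dsimp only
        linarith
      · have a4 := hα eL (removePair eR) s'
        have a5 := hβ eL (removePair eR) R
        dsimp only
        linarith
      · dsimp only
        linarith
    · have a1 := hβ eL eR s'
      have a2 := hβ eL eR R
      have a3 := hα eL eR L
      split_ifs
      · have a4 := hβ eL (storePair eR) s'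
        have a5 := hα eL (storePair eR) L
        dsimp only
        linarith
      · have a4 := hβ (removePair eL) eR s'
        have a5 := hα (removePair eL) eR L
        dsimp only
        linarith
      · dsimp only
        linarith
  linarith

/-! ### Throughput of birth and death chains -/

/-- Detailed balance for a birth and death chain on `0, …, N` with birth rates `lam` and death
rates `mu`, with mean birth rate `T`. -/
structure IsBalanced (N : ℕ) (lam mu π : ℕ → ℝ) (T : ℝ) : Prop where
  nonneg : ∀ k ≤ N, 0 ≤ π k
  pos : 0 < ∑ k ∈ Finset.range (N + 1), π k
  balance : ∀ k < N, π k * lam k = π (k + 1) * mu (k + 1)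
  top : lam N = 0
  bot : mu 0 = 0
  mean : T * ∑ k ∈ Finset.range (N + 1), π k = ∑ k ∈ Finset.range (N + 1), π k * lam k

theorem IsBalanced.sum_death {N : ℕ} {lam mu π : ℕ → ℝ} {T : ℝ} (h : IsBalanced N lam mu π T) :
    ∑ k ∈ Finset.range (N + 1), π k * mu k = ∑ k ∈ Finset.range (N + 1), π k * lam k := by
  rw [Finset.sum_range_succ', Finset.sum_range_succ, h.top, h.bot]
  simp only [mul_zero, add_zero]
  exact Finset.sum_congr rfl fun k hk => (h.balance k (Finset.mem_range.1 hk)).symm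

/-- If `χ` solves the Poisson equation for larger rates and takes values in `[0, 1]`, then the
throughput for the larger rates is larger. -/
theorem IsBalanced.le {N : ℕ} {lam mu π : ℕ → ℝ} {T : ℝ} (h : IsBalanced N lam mu π T)
    {lam' mu' χ : ℕ → ℝ} {T' : ℝ} (hlam : ∀ k ≤ N, lam k ≤ lam' k) (hmu : ∀ k ≤ N, mu k ≤ mu' k)
    (h0 : ∀ k, 0 ≤ χ k) (h1 : ∀ k, χ k ≤ 1)
    (heq : ∀ k ≤ N, lam' k * χ (k + 1) + mu' k * (1 - χ k) = T') : T ≤ T' := by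
  -- Detailed balance makes the `χ` terms cancel, so this average is the throughput whatever `χ` is.
  have e : ∑ k ∈ Finset.range (N + 1), π k * (lam k * χ (k + 1) + mu k * (1 - χ k)) =
      T * ∑ k ∈ Finset.range (N + 1), π k := by
    have e1 : ∑ k ∈ Finset.range (N + 1), π k * lam k * χ (k + 1) =
        ∑ k ∈ Finset.range (N + 1), π k * mu k * χ k := by
      rw [Finset.sum_range_succ, Finset.sum_range_succ', h.top, h.bot]
      simp only [mul_zero, zero_mul, add_zero]
      exact Finset.sum_congr rfl fun k hk => by rw [h.balance k (Finset.mem_range.1 hk)]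
    rw [h.mean, ← h.sum_death]
    have : ∀ k, π k * (lam k * χ (k + 1) + mu k * (1 - χ k)) =
        π k * lam k * χ (k + 1) - π k * mu k * χ k + π k * mu k := fun k => by ring
    simp only [this, Finset.sum_add_distrib, Finset.sum_sub_distrib, e1, sub_self, zero_add]
  have l : ∑ k ∈ Finset.range (N + 1), π k * (lam k * χ (k + 1) + mu k * (1 - χ k)) ≤
      T' * ∑ k ∈ Finset.range (N + 1), π k := by
    rw [Finset.mul_sum]
    refine Finset.sum_le_sum fun k hk => ?_
    have hk' : k ≤ N := Nat.lt_succ_iff.1 (Finset.mem_range.1 hk)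
    rw [← heq k hk', mul_comm _ (π k)]
    exact mul_le_mul_of_nonneg_left (add_le_add
      (mul_le_mul_of_nonneg_right (hlam k hk') (h0 _))
      (mul_le_mul_of_nonneg_right (hmu k hk') (by linarith [h1 k]))) (h.nonneg k hk')
  rw [e] at l
  exact le_of_mul_le_mul_right l h.pos

/-- Partial sums of a centred, weighted antitone sequence are nonnegative. -/
theorem sum_range_nonneg_of_antitone {N : ℕ} {w a : ℕ → ℝ} (hw : ∀ k ≤ N, 0 ≤ w k)
    (ha : ∀ j k, j ≤ k → k ≤ N → a k ≤ a j)
    (h : ∑ k ∈ Finset.range (N + 1), w k * a k = 0) {m : ℕ} (hm : m ≤ N + 1) :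
    0 ≤ ∑ k ∈ Finset.range m, w k * a k := by
  rcases Nat.eq_zero_or_pos m with rfl | hpos
  · simp
  -- If the last term of the partial sum is nonnegative, so are all earlier ones; otherwise the
  -- remaining tail is nonpositive and the total is zero.
  by_cases hc : 0 ≤ a (m - 1)
  · refine Finset.sum_nonneg fun k hk => ?_
    rw [Finset.mem_range] at hk
    exact mul_nonneg (hw k (by omega)) (hc.trans (ha k (m - 1) (by omega) (by omega)))
  · rw [← Finset.sum_range_add_sum_Ico _ hm] at h
    have : ∑ k ∈ Finset.Ico m (N + 1), w k * a k ≤ 0 := by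
      refine Finset.sum_nonpos fun k hk => ?_
      rw [Finset.mem_Ico] at hk
      exact mul_nonpos_of_nonneg_of_nonpos (hw k (by omega))
        ((ha (m - 1) k (by omega) (by omega)).trans (not_le.1 hc).le)
    linarith

/-- Multiplied by `π k`, the equation telescopes, which forces `π k * mu k * χ k = S k`, the partial
sum of `π j * (T - mu j)`. Both `S k` and its complement, the partial sum of `π j * (lam j - T)`,
are partial sums of centred antitone sequences; this gives `0 ≤ χ ≤ 1`. -/
theorem exists_isBalanced_poisson {N : ℕ} (hN : 0 < N) {lam mu : ℕ → ℝ}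
    (hlam : ∀ k < N, 0 < lam k) (hmu : ∀ k < N, 0 < mu (k + 1)) (htop : lam N = 0) (hbot : mu 0 = 0)
    (hanti : ∀ j k, j ≤ k → k ≤ N → lam k ≤ lam j) (hmono : ∀ j k, j ≤ k → k ≤ N → mu j ≤ mu k) :
    ∃ (T : ℝ) (π χ : ℕ → ℝ), 0 < T ∧ IsBalanced N lam mu π T ∧ (∀ k, 0 ≤ χ k) ∧ (∀ k, χ k ≤ 1) ∧
      ∀ k ≤ N, lam k * χ (k + 1) + mu k * (1 - χ k) = T := by
  set π : ℕ → ℝ := fun k => ∏ j ∈ Finset.range k, lam j / mu (j + 1) with hπ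
  have hpos : ∀ k ≤ N, 0 < π k := fun k hk => Finset.prod_pos fun j hj => by
    rw [Finset.mem_range] at hj
    exact div_pos (hlam j (by omega)) (hmu j (by omega))
  have hZ : 0 < ∑ k ∈ Finset.range (N + 1), π k :=
    Finset.sum_pos (fun k hk => hpos k (Nat.lt_succ_iff.1 (Finset.mem_range.1 hk))) (by simp)
  have hbal : ∀ k < N, π k * lam k = π (k + 1) * mu (k + 1) := fun k hk => by
    have := (hmu k hk).ne'
    simp only [hπ, Finset.prod_range_succ]
    field_simp
  set T : ℝ := (∑ k ∈ Finset.range (N + 1), π k * lam k) / ∑ k ∈ Finset.range (N + 1), π k with hT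
  have hmean : T * ∑ k ∈ Finset.range (N + 1), π k = ∑ k ∈ Finset.range (N + 1), π k * lam k :=
    div_mul_cancel₀ _ hZ.ne'
  have hB : IsBalanced N lam mu π T :=
    ⟨fun k hk => (hpos k hk).le, hZ, hbal, htop, hbot, hmean⟩
  have hTpos : 0 < T := by
    refine div_pos ?_ hZ
    rw [Finset.sum_range_succ, htop, mul_zero, add_zero]
    exact Finset.sum_pos (fun k hk => mul_pos (hpos k (Finset.mem_range.1 hk).le)
      (hlam k (Finset.mem_range.1 hk))) (by simpa using hN.ne')
  have z1 : ∑ k ∈ Finset.range (N + 1), π k * (T - mu k) = 0 := by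
    simp only [mul_sub, Finset.sum_sub_distrib, hB.sum_death, ← hmean, ← Finset.sum_mul]
    ring
  have z2 : ∑ k ∈ Finset.range (N + 1), π k * (lam k - T) = 0 := by
    simp only [mul_sub, Finset.sum_sub_distrib, ← hmean, ← Finset.sum_mul]
    ring
  have tele : ∀ k < N, ∑ j ∈ Finset.range (k + 1), π j * (lam j - mu j) = π k * lam k := by
    intro k
    induction k with
    | zero => intro _; simp [hbot]
    | succ k ih =>
      intro hk
      rw [Finset.sum_range_succ, ih (by omega), hbal k (by omega)]
      ring
  set S : ℕ → ℝ := fun k => ∑ j ∈ Finset.range k, π j * (T - mu j) with hS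
  have hS0 : ∀ k ≤ N + 1, 0 ≤ S k := fun k hk =>
    sum_range_nonneg_of_antitone hB.nonneg
      (fun i j hij hj => sub_le_sub_left (hmono i j hij hj) T) z1 hk
  have hS1 : ∀ k < N, S (k + 1) ≤ π k * lam k := fun k hk => by
    have := sum_range_nonneg_of_antitone hB.nonneg
      (fun i j hij hj => sub_le_sub_right (hanti i j hij hj) T) z2 (m := k + 1) (by omega)
    rw [← tele k hk, ← sub_nonneg, hS, ← Finset.sum_sub_distrib]
    convert this using 2
    ring
  -- By balance the denominator is `π k * mu k`. The value `0` outside `1, …, N` is harmless: there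
  -- `χ` is multiplied by `mu 0 = 0` or `lam N = 0`.
  refine ⟨T, π, fun k => if k = 0 ∨ N < k then 0 else S k / (π (k - 1) * lam (k - 1)), hTpos, hB,
    fun k => ?_, fun k => ?_, fun k hk => ?_⟩
  · dsimp only
    split_ifs with h
    · exact le_rfl
    · exact div_nonneg (hS0 k (by omega))
        (mul_pos (hpos _ (by omega)) (hlam _ (by omega))).le
  · dsimp only
    split_ifs with h
    · exact zero_le_one
    · refine div_le_one_of_le₀ ?_ (mul_pos (hpos _ (by omega)) (hlam _ (by omega))).le
      obtain ⟨k, rfl⟩ := Nat.exists_eq_succ_of_ne_zero (n := k) (by omega)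
      exact hS1 k (by omega)
  · have hup : π k * (lam k * (if k + 1 = 0 ∨ N < k + 1 then 0 else
        S (k + 1) / (π (k + 1 - 1) * lam (k + 1 - 1)))) = S (k + 1) := by
      rcases hk.eq_or_lt with rfl | hlt
      · rw [htop, hS]
        simp only [z1]
        simp
      · rw [if_neg (by omega)]
        have := (hpos k hk).ne'
        have := (hlam k hlt).ne'
        simp only [Nat.add_sub_cancel]
        field_simp
    have hdown : π k * (mu k * (if k = 0 ∨ N < k then 0 else
        S k / (π (k - 1) * lam (k - 1)))) = S k := by
      rcases Nat.eq_zero_or_pos k with rfl | hk0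
      · simp [hS]
      · obtain ⟨k, rfl⟩ := Nat.exists_eq_succ_of_ne_zero hk0.ne'
        rw [if_neg (by omega)]
        simp only [Nat.succ_eq_add_one, Nat.add_sub_cancel]
        rw [hbal k (by omega), ← mul_assoc]
        exact mul_div_cancel₀ _ (mul_pos (hpos _ hk) (hmu k (by omega))).ne'
    refine mul_left_cancel₀ (hpos k hk).ne' ?_
    have hs : S (k + 1) = S k + π k * (T - mu k) := Finset.sum_range_succ _ _
    rw [mul_sub, mul_one, mul_add, mul_sub, hup, hdown, hs]
    ring

/-! ### Rate tables and the recursion for the coefficients -/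

/-- `R u v` is a decreasing table of rates, vanishing when an end has no free memory, and bounded
below by `f b` when `b` memories are free at both ends. -/
structure IsRateTable (B : ℕ) (f : ℕ → ℝ) (R : ℕ → ℕ → ℝ) : Prop where
  pos : ∀ u v, u < B → v < B → 0 < R u v
  zero : ∀ u v, B ≤ u ∨ B ≤ v → R u v = 0
  anti : ∀ u v u' v', u ≤ u' → v ≤ v' → R u' v' ≤ R u v
  le : ∀ b, 1 ≤ b → b ≤ B → f b ≤ R (B - b) (B - b)

theorem IsRateTable.nonneg {B : ℕ} {f : ℕ → ℝ} {R : ℕ → ℕ → ℝ} (h : IsRateTable B f R) (u v : ℕ) :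
    0 ≤ R u v := by
  by_cases hB : B ≤ u ∨ B ≤ v
  · exact (h.zero u v hB).ge
  · exact (h.pos u v (by omega) (by omega)).le

/-- The rate at which the left half produces pairs when it has `X` more of them stored than the
right half. -/
def leftRate (R : ℕ → ℕ → ℝ) (u : ℕ) (X : ℤ) : ℝ := R (u + X.toNat) X.toNat

/-- The rate at which the right half produces pairs when the left half has `X` more of them
stored. -/
def rightRate (R : ℕ → ℕ → ℝ) (v : ℕ) (X : ℤ) : ℝ := R (-X).toNat (v + (-X).toNat)

/-- One step of the recursion for the coefficients. -/
noncomputable def coeffStep (f : ℕ → ℝ) (b : ℕ) : ℝ :=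
  f b * (1 - (1 + 2 * ∑ j ∈ Finset.range b,
    (∏ j₀ ∈ Finset.range (j + 1), f (b - j₀)) / f b ^ (j + 1))⁻¹)

theorem coeffStep_pos {f : ℕ → ℝ} (hf : ∀ b, 1 ≤ b → 0 < f b) {b : ℕ} (hb : 1 ≤ b) :
    0 < coeffStep f b := by
  refine mul_pos (hf b hb) (sub_pos.2 (inv_lt_one_of_one_lt₀ ?_))
  have : 0 < ∑ j ∈ Finset.range b, (∏ j₀ ∈ Finset.range (j + 1), f (b - j₀)) / f b ^ (j + 1) :=
    Finset.sum_pos (fun j hj => div_pos (Finset.prod_pos fun k hk => hf _ (by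
      rw [Finset.mem_range] at hj hk; omega)) (pow_pos (hf b hb) _))
      (Finset.nonempty_range_iff.2 (by omega))
  linarith

/-- The birth and death chain whose throughput is given by `coeffStep`. -/
theorem exists_isBalanced_coeffStep {f : ℕ → ℝ} (hf : ∀ b, 1 ≤ b → 0 < f b) {b : ℕ} (hb : 1 ≤ b) :
    ∃ π : ℕ → ℝ, IsBalanced (2 * b) (fun k => if k < 2 * b then f (b - (k - b)) else 0)
      (fun k => if 0 < k then f (b - (b - k)) else 0) π (coeffStep f b) := by
  have hfb := hf b hb
  -- Index `k` stands for the difference `k - b`, and `w m` is the weight of the differences `m` and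
  -- `-m` relative to `0`. With truncated subtraction one of `k - b`, `b - k` vanishes, so `w (k -
  -- b) * w (b - k)` is the weight of `k`. The rates are cut off at the ends because `f 0` need not
  -- vanish.
  set w : ℕ → ℝ := fun m => (∏ j₀ ∈ Finset.range m, f (b - j₀)) / f b ^ m with hw
  have hw0 : w 0 = 1 := by simp [hw]
  have hpos : ∀ m ≤ b, 0 < w m := fun m hm => div_pos (Finset.prod_pos fun k hk => hf _ (by
      rw [Finset.mem_range] at hk; omega)) (pow_pos hfb _)
  have hstep : ∀ m, w m * f (b - m) = w (m + 1) * f b := fun m => by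
    simp only [hw, Finset.prod_range_succ, pow_succ]
    field_simp
  set S : ℝ := ∑ j ∈ Finset.range b, w (j + 1) with hS
  have hS0 : 0 ≤ S := Finset.sum_nonneg fun j hj => (hpos _ (Finset.mem_range.1 hj)).le
  have hrefl : ∀ g : ℕ → ℝ, (∀ k < b, g k = w (b - k)) → ∑ k ∈ Finset.range b, g k = S := by
    intro g hg
    rw [hS, ← Finset.sum_range_reflect]
    refine Finset.sum_congr rfl fun k hk => ?_
    rw [Finset.mem_range] at hk
    rw [hg _ (by omega), show b - (b - 1 - k) = k + 1 by omega]
  have hZ : ∑ k ∈ Finset.range (2 * b + 1), w (k - b) * w (b - k) = 1 + 2 * S := by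
    rw [two_mul, add_assoc, Finset.sum_range_add,
      hrefl _ fun k hk => by rw [Nat.sub_eq_zero_of_le hk.le, hw0, one_mul], Finset.sum_range_succ']
    simp only [Nat.add_sub_cancel_left, Nat.sub_add_eq, Nat.sub_self, Nat.zero_sub, hw0, mul_one,
      add_zero]
    rw [← hS]
    ring
  refine ⟨fun k => w (k - b) * w (b - k), ⟨fun k hk =>
    (mul_pos (hpos _ (by omega)) (hpos _ (by omega))).le, ?_, fun k hk => ?_, by simp, by simp, ?_⟩⟩
  · rw [hZ]
    linarith
  · simp only [hk, if_true, Nat.succ_pos]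
    rcases lt_or_ge k b with h | h
    · rw [show k - b = 0 by omega, show k + 1 - b = 0 by omega, hw0, one_mul, one_mul, Nat.sub_zero,
        hstep, show b - (k + 1) + 1 = b - k by omega]
    · rw [show b - k = 0 by omega, show b - (k + 1) = 0 by omega, hw0, mul_one, mul_one,
        Nat.sub_zero, hstep, show k - b + 1 = k + 1 - b by omega]
  · rw [hZ, show 2 * b + 1 = b + (b + 1) by omega, Finset.sum_range_add]
    have e1 : ∑ k ∈ Finset.range b, w (k - b) * w (b - k) *
        (if k < 2 * b then f (b - (k - b)) else 0) = S * f b := by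
      rw [← hrefl (fun k => w (b - k)) fun _ _ => rfl, Finset.sum_mul]
      refine Finset.sum_congr rfl fun k hk => ?_
      rw [Finset.mem_range] at hk
      rw [if_pos (by omega), show k - b = 0 by omega, hw0, one_mul, Nat.sub_zero]
    have e2 : ∑ k ∈ Finset.range (b + 1), w (b + k - b) * w (b - (b + k)) *
        (if b + k < 2 * b then f (b - (b + k - b)) else 0) = S * f b := by
      rw [Finset.sum_range_succ, if_neg (by omega), mul_zero, add_zero, hS, Finset.sum_mul]
      refine Finset.sum_congr rfl fun k hk => ?_
      rw [Finset.mem_range] at hk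
      rw [if_pos (by omega), show b + k - b = k by omega, show b - (b + k) = 0 by omega, hw0,
        mul_one, hstep]
    rw [e1, e2]
    have : coeffStep f b = f b * (1 - (1 + 2 * S)⁻¹) := rfl
    rw [this]
    have : 1 + 2 * S ≠ 0 := by linarith
    field_simp
    ring

/-- The throughputs of the slow birth and death chains of the difference of the stored pairs of
the two halves, with the solutions of their Poisson equations. -/
theorem IsRateTable.exists_next {B : ℕ} {f : ℕ → ℝ} {R : ℕ → ℕ → ℝ} (hR : IsRateTable B f R)
    (hf : ∀ b, 1 ≤ b → 0 < f b) :
    ∃ (T : ℕ → ℕ → ℝ) (ψ : ℕ → ℕ → ℤ → ℝ), IsRateTable B (coeffStep f) T ∧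
      (∀ u v X, 0 ≤ ψ u v X ∧ ψ u v X ≤ 1) ∧
      ∀ u v, u ≤ B → v ≤ B → ∀ X : ℤ, (v : ℤ) - B ≤ X → X ≤ B - u →
        leftRate R u X * ψ u v X + rightRate R v X * (1 - ψ u v (X - 1)) = T u v := by
  have key : ∀ u v, ∃ (T : ℝ) (ψ : ℤ → ℝ), (∀ X, 0 ≤ ψ X ∧ ψ X ≤ 1) ∧ (B ≤ u ∨ B ≤ v → T = 0) ∧
      (u ≤ B → v ≤ B → ∀ X : ℤ, (v : ℤ) - B ≤ X → X ≤ B - u →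
        leftRate R u X * ψ X + rightRate R v X * (1 - ψ (X - 1)) = T) ∧
      (u < B → v < B → 0 < T ∧ ∃ π, IsBalanced (2 * B - u - v)
        (fun k => leftRate R u (v - B + k)) (fun k => rightRate R v (v - B + k)) π T) := by
    intro u v
    by_cases hu : B ≤ u
    -- The left half is blocked, and the weight `1 - ψ = 0` removes the right half from the
    -- equation.
    · refine ⟨0, fun _ => 1, fun X => by simp, fun _ => rfl, fun _ _ X _ _ => ?_, by omega⟩
      rw [leftRate, hR.zero _ _ (by omega)]
      ring
    by_cases hv : B ≤ v
    · refine ⟨0, fun _ => 0, fun X => by simp, fun _ => rfl, fun _ _ X _ _ => ?_, by omega⟩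
      rw [rightRate, hR.zero _ _ (by omega)]
      ring
    push Not at hu hv
    obtain ⟨T, π, χ, hT, hB, h0, h1, he⟩ := exists_isBalanced_poisson (N := 2 * B - u - v) (by omega)
      (lam := fun k => leftRate R u (v - B + k)) (mu := fun k => rightRate R v (v - B + k))
      (fun k hk => hR.pos _ _ (by omega) (by omega)) (fun k hk => hR.pos _ _ (by omega) (by omega))
      (hR.zero _ _ (by omega)) (hR.zero _ _ (by omega))
      (fun j k hjk hk => hR.anti _ _ _ _ (by omega) (by omega))
      (fun j k hjk hk => hR.anti _ _ _ _ (by omega) (by omega))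
    -- Index `k` is the difference `X = v - B + k`; the shift by one is there because `χ k` belongs
    -- to the step from `k - 1` to `k` and `ψ X` to the step from `X` to `X + 1`.
    refine ⟨T, fun X => χ (X + 1 - (v - B)).toNat, fun X => ⟨h0 _, h1 _⟩, by omega,
      fun _ _ X hX1 hX2 => ?_, fun _ _ => ⟨hT, π, hB⟩⟩
    have := he (X - (v - B)).toNat (by omega)
    rw [show ((v : ℤ) - B + (X - (v - B)).toNat) = X by omega] at this
    dsimp only
    rw [← this, show (X + 1 - (v - B)).toNat = (X - (v - B)).toNat + 1 by omega, sub_add_cancel]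
  choose T ψ hψ hT0 hTe hTb using key
  have hTnonneg : ∀ u v, 0 ≤ T u v := fun u v => by
    by_cases h : B ≤ u ∨ B ≤ v
    · exact (hT0 u v h).ge
    · exact (hTb u v (by omega) (by omega)).1.le
  refine ⟨T, ψ, ⟨fun u v hu hv => (hTb u v hu hv).1, hT0, fun u v u' v' hu hv => ?_,
    fun b hb hbB => ?_⟩, hψ, hTe⟩
  · by_cases h : B ≤ u' ∨ B ≤ v'
    · rw [hT0 u' v' h]
      exact hTnonneg u v
    obtain ⟨-, π, hπ⟩ := hTb u' v' (by omega) (by omega)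
    refine hπ.le (lam' := fun k => leftRate R u (v' - B + k))
      (mu' := fun k => rightRate R v (v' - B + k)) (χ := fun k => ψ u v (v' - B + k - 1))
      (fun k hk => hR.anti _ _ _ _ (by omega) (by omega))
      (fun k hk => hR.anti _ _ _ _ (by omega) (by omega))
      (fun k => (hψ _ _ _).1) (fun k => (hψ _ _ _).2) fun k hk => ?_
    rw [← hTe u v (by omega) (by omega) (v' - B + k) (by omega) (by omega)]
    simp only [Nat.cast_add, Nat.cast_one, ← add_assoc, add_sub_cancel_right]
  · obtain ⟨π, hπ⟩ := exists_isBalanced_coeffStep hf hb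
    -- Raising the smaller number of blocked memories to the larger one only lowers the rate, and on
    -- the diagonal the table dominates `f`.
    have hlow : ∀ m < b, ∀ u v, u ≤ B - b + m → v ≤ B - b + m → f (b - m) ≤ R u v :=
      fun m hm u v hu hv => (hR.le (b - m) (by omega) (by omega)).trans
        (hR.anti _ _ _ _ (by omega) (by omega))
    refine hπ.le (lam' := fun k => leftRate R (B - b) (k - b))
      (mu' := fun k => rightRate R (B - b) (k - b))
      (χ := fun k => ψ (B - b) (B - b) (k - b - 1)) (fun k hk => ?_) (fun k hk => ?_)
      (fun k => (hψ _ _ _).1) (fun k => (hψ _ _ _).2) fun k hk => ?_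
    · split_ifs with h
      · exact hlow _ (by omega) _ _ (by omega) (by omega)
      · exact hR.nonneg _ _
    · split_ifs with h
      · exact hlow _ (by omega) _ _ (by omega) (by omega)
      · exact hR.nonneg _ _
    · rw [← hTe (B - b) (B - b) (by omega) (by omega) (k - b) (by omega) (by omega),
        show ((k + 1 : ℕ) : ℤ) - b - 1 = k - b by omega]

/-! ### Separation of time scales: passing from halves to the whole -/

/-- Creations happen at rate `q ^ n * R u v` up to higher order terms, in the sense of one-sided
approximate solutions of the Poisson equation. -/
def HasRate (B n : ℕ) (R : ℕ → ℕ → ℝ) : Prop :=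
  ∃ C > 0, ∃ q₀ > 0, ∀ q : ℝ, 0 < q → q ≤ q₀ → q ≤ 1 → ∀ c : ℝ, |c| ≤ 1 →
    ∃ h : ℕ → ℕ → ChainState B n → ℝ, (∀ u v s, |h u v s| ≤ C * q) ∧
      ∀ u v s, s.Admissible n u v →
        c * creation q u v s ≤ c * (q ^ n * R u v) + C * q ^ (n + 1) + drift q u v (h u v) s

/-- Storing a left pair and consuming a stored right pair both raise the difference by one, whether
or not the swap succeeds. Admissibility ensures that storing is not truncated. -/
theorem drift_succ_difference (q : ℝ) {B n : ℕ} {u v : ℕ} (φ : ℤ → ℝ)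
    {L R : ChainState B n} {eL eR : Fin (B + 1)}
    (hL : L.Admissible n (u + eL) eL) (hR : R.Admissible n eR (v + eR)) :
    drift (n := n + 1) q u v (fun s => φ ((s.2.2.1 : ℕ) - (s.2.2.2 : ℕ))) (L, R, eL, eR) =
      (φ ((eL : ℕ) - (eR : ℕ) + 1) - φ ((eL : ℕ) - (eR : ℕ))) * creation q (u + eL) eL L +
      (φ ((eL : ℕ) - (eR : ℕ) - 1) - φ ((eL : ℕ) - (eR : ℕ))) * creation q eR (v + eR) R := by
  refine (eventSum_succ q u v _ L R eL eR).trans ?_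
  simp only [creation]
  rw [← eventSum_const_mul, ← eventSum_const_mul]
  congr 1
  · refine eventSum_congr q hL fun s' b hb => ?_
    split_ifs with h h0
    · have := (hb h).le
      rw [storePair_val this.2, mul_one]
      push_cast
      congr 2
      ring
    · have : 0 < (eR : ℕ) := Nat.pos_of_ne_zero fun h => h0 (Fin.ext h)
      rw [removePair_val, Nat.cast_pred this,
        show ((eL : ℕ) : ℤ) - ((eR : ℕ) - 1) = (eL : ℕ) - (eR : ℕ) + 1 by ring]
      ring
    · simp
  · refine eventSum_congr q hR fun s' b hb => ?_
    split_ifs with h h0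
    · have := (hb h).le
      rw [storePair_val this.1, mul_one]
      push_cast
      congr 2
      ring
    · have : 0 < (eL : ℕ) := Nat.pos_of_ne_zero fun h => h0 (Fin.ext h)
      rw [removePair_val, Nat.cast_pred this,
        show ((eL : ℕ) : ℤ) - 1 - (eR : ℕ) = (eL : ℕ) - (eR : ℕ) - 1 by ring]
      ring
    · simp

theorem exists_primitive_int (B : ℕ) {δ : ℤ → ℝ} (hδ : ∀ X, |δ X| ≤ 1) :
    ∃ φ : ℤ → ℝ, (∀ X, -(B : ℤ) - 1 ≤ X → φ (X + 1) - φ X = δ X) ∧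
      ∀ X : ℤ, X ≤ B → |φ X| ≤ 2 * B + 1 := by
  refine ⟨fun X => ∑ j ∈ Finset.Ico (-(B : ℤ) - 1) X, δ j, fun X hX => ?_, fun X hX => ?_⟩
  · have : Finset.Ico (-(B : ℤ) - 1) (X + 1) = insert X (Finset.Ico (-(B : ℤ) - 1) X) := by
      ext y
      simp only [Finset.mem_Ico, Finset.mem_insert]
      omega
    dsimp only
    rw [this, Finset.sum_insert (by simp)]
    ring
  · refine (Finset.abs_sum_le_sum_abs _ _).trans ((Finset.sum_le_card_nsmul _ _ 1
      fun j _ => hδ j).trans ?_)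
    rw [Int.card_Ico, nsmul_eq_mul, mul_one]
    exact_mod_cast (by omega : (X - (-(B : ℤ) - 1)).toNat ≤ 2 * B + 1)

/-- The drift of `φ` turns the indicators of a swap in `creation` into the weights `ψ X` and `1 - ψ
(X - 1)` for left and right creations. The hypothesis for the halves is applied with `c` times these
weights, which is why `HasRate` allows every `|c| ≤ 1`; then `hT` makes the leading terms constant.
-/
theorem HasRate.succ {B n : ℕ} {f : ℕ → ℝ} {R T : ℕ → ℕ → ℝ} {ψ : ℕ → ℕ → ℤ → ℝ}
    (hR : IsRateTable B f R) (h : HasRate B n R)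
    (hψ : ∀ u v X, 0 ≤ ψ u v X ∧ ψ u v X ≤ 1)
    (hT : ∀ u v, u ≤ B → v ≤ B → ∀ X : ℤ, (v : ℤ) - B ≤ X → X ≤ B - u →
        leftRate R u X * ψ u v X + rightRate R v X * (1 - ψ u v (X - 1)) = T u v) :
    HasRate B (n + 1) T := by
  obtain ⟨C, hC, q₀, hq₀, H⟩ := h
  have hK := hR.nonneg 0 0
  set K := R 0 0
  have hφ : ∀ u v, ∃ φ : ℤ → ℝ,
      (∀ X, -(B : ℤ) - 1 ≤ X → φ (X + 1) - φ X = ψ u v X - if X < 0 then 1 else 0) ∧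
      ∀ X : ℤ, X ≤ B → |φ X| ≤ 2 * B + 1 := fun u v =>
    exists_primitive_int B (δ := fun X => ψ u v X - if X < 0 then 1 else 0) fun X => by
    have := hψ u v X
    rw [abs_le]
    split_ifs <;> constructor <;> linarith
  choose φ hφd hφb using hφ
  -- The first three summands bound the corrector, the bracket bounds the error. The condition `8 *
  -- C * q ≤ 1` lets half of the creation rate absorb the loss in `l3`.
  refine ⟨(2 * B + 1) + 2 * C + 16 * C ^ 2 + (2 * C + 16 * C * K + 16 * C ^ 2), by positivity,
    min q₀ (1 / (8 * C)), by positivity, fun q hq hqq hq1 c hc => ?_⟩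
  have hqC : q * (8 * C) ≤ 1 := by
    have := hqq.trans (min_le_right _ _)
    rwa [le_div_iff₀ (by positivity)] at this
  choose h hb hd using H q hq (hqq.trans (min_le_left _ _)) hq1
  have hc1 : ∀ x : ℝ, 0 ≤ x → x ≤ 1 → |c * x| ≤ 1 := fun x h0 h1 => by
    rw [abs_mul, abs_of_nonneg h0]
    exact mul_le_one₀ hc h0 h1
  have c1 : ∀ u v X, |c * ψ u v X| ≤ 1 := fun u v X => hc1 _ (hψ u v X).1 (hψ u v X).2
  have c2 : ∀ u v X, |c * (1 - ψ u v (X - 1))| ≤ 1 := fun u v X =>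
    hc1 _ (by linarith [(hψ u v (X - 1)).2]) (by linarith [(hψ u v (X - 1)).1])
  have c3 : |(1 : ℝ)| ≤ 1 := by simp
  set α : ℕ → ℕ → Fin (B + 1) → Fin (B + 1) → ChainState B n → ℝ := fun u v a b s =>
    h _ (c1 u v ((a : ℕ) - (b : ℕ))) (u + a) a s
  set β : ℕ → ℕ → Fin (B + 1) → Fin (B + 1) → ChainState B n → ℝ := fun u v a b s =>
    h _ (c2 u v ((a : ℕ) - (b : ℕ))) b (v + b) s
  set γ : ℕ → Fin (B + 1) → Fin (B + 1) → ChainState B n → ℝ := fun u a b s =>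
    h 1 c3 (u + a) a s
  set δ : ℕ → Fin (B + 1) → Fin (B + 1) → ChainState B n → ℝ := fun v a b s =>
    h 1 c3 b (v + b) s
  -- `φ` balances the slow chain, `α` and `β` replace the creation rates of the halves by their
  -- tables, and `γ`, `δ` (weight `1`) pay for the jumps of `α` and `β` at creations: these cost `4
  -- * C * q ^ 2` per creation, and half of `8 * C * q ^ 2` survives.
  refine ⟨fun u v s => -(q * c) * φ u v ((s.2.2.1 : ℕ) - (s.2.2.2 : ℕ)) +
    (q * (α u v s.2.2.1 s.2.2.2 s.1 + β u v s.2.2.1 s.2.2.2 s.2.1) +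
      8 * C * q ^ 2 * (γ u s.2.2.1 s.2.2.2 s.1 + δ v s.2.2.1 s.2.2.2 s.2.1)),
    fun u v s => ?_, fun u v s hs => ?_⟩
  · obtain ⟨L, R', eL, eR⟩ := s
    have b0 : |φ u v ((eL : ℕ) - (eR : ℕ))| ≤ 2 * B + 1 := hφb u v _ (by omega)
    have b1 : |α u v eL eR L| ≤ C * q := hb _ _ _ _ _
    have b2 : |β u v eL eR R'| ≤ C * q := hb _ _ _ _ _
    have b3 : |γ u eL eR L| ≤ C * q := hb _ _ _ _ _
    have b4 : |δ v eL eR R'| ≤ C * q := hb _ _ _ _ _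
    have d0 : |-(q * c) * φ u v ((eL : ℕ) - (eR : ℕ))| ≤ q * (2 * B + 1) := by
      rw [abs_mul, abs_neg, abs_mul, abs_of_pos hq]
      refine mul_le_mul ?_ b0 (abs_nonneg _) hq.le
      exact mul_le_of_le_one_right hq.le hc
    have d1 : |q * (α u v eL eR L + β u v eL eR R')| ≤ q * (2 * C * q) := by
      rw [abs_mul, abs_of_pos hq]
      exact mul_le_mul_of_nonneg_left ((abs_add_le _ _).trans (by linarith)) hq.le
    have d2 : |8 * C * q ^ 2 * (γ u eL eR L + δ v eL eR R')| ≤ 8 * C * q ^ 2 * (2 * C * q) := by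
      rw [abs_mul, abs_of_pos (by positivity : 0 < 8 * C * q ^ 2)]
      exact mul_le_mul_of_nonneg_left ((abs_add_le _ _).trans (by linarith)) (by positivity)
    refine (abs_add_le _ _).trans ((add_le_add d0 ((abs_add_le _ _).trans
      (add_le_add d1 d2))).trans ?_)
    have q2 : q ^ 2 ≤ q := by nlinarith
    have q3 : q ^ 3 ≤ q := by nlinarith
    have m2 := mul_le_mul_of_nonneg_left q2 hC.le
    have m3 := mul_le_mul_of_nonneg_left q3 (by positivity : 0 ≤ C ^ 2)
    have p0 : 0 ≤ (2 * C + 16 * C * K + 16 * C ^ 2) * q := by positivity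
    linarith
  · have hdr : ∀ s : ChainState B (n + 1), drift q u v (fun s : ChainState B (n + 1) =>
        -(q * c) * φ u v ((s.2.2.1 : ℕ) - (s.2.2.2 : ℕ)) +
        (q * (α u v s.2.2.1 s.2.2.2 s.1 + β u v s.2.2.1 s.2.2.2 s.2.1) +
          8 * C * q ^ 2 * (γ u s.2.2.1 s.2.2.2 s.1 + δ v s.2.2.1 s.2.2.2 s.2.1))) s =
        -(q * c) * drift q u v (fun s : ChainState B (n + 1) =>
          φ u v ((s.2.2.1 : ℕ) - (s.2.2.2 : ℕ))) s +
        (q * drift q u v (fun s : ChainState B (n + 1) =>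
          α u v s.2.2.1 s.2.2.2 s.1 + β u v s.2.2.1 s.2.2.2 s.2.1) s +
        8 * C * q ^ 2 * drift q u v (fun s : ChainState B (n + 1) =>
          γ u s.2.2.1 s.2.2.2 s.1 + δ v s.2.2.1 s.2.2.2 s.2.1) s) := fun s => by
      rw [← drift_const_mul, ← drift_const_mul, ← drift_const_mul, ← drift_add, ← drift_add]
    obtain ⟨L, R', eL, eR⟩ := s
    obtain ⟨h0, hL, hR'⟩ := hs
    have leL := hL.le
    have leR := hR'.le
    obtain ⟨D1, hD1⟩ : ∃ D, drift (n := n + 1) q u v (fun s =>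
      α u v s.2.2.1 s.2.2.2 s.1 + β u v s.2.2.1 s.2.2.2 s.2.1) (L, R', eL, eR) = D := ⟨_, rfl⟩
    obtain ⟨D2, hD2⟩ : ∃ D, drift (n := n + 1) q u v (fun s =>
      γ u s.2.2.1 s.2.2.2 s.1 + δ v s.2.2.1 s.2.2.2 s.2.1) (L, R', eL, eR) = D := ⟨_, rfl⟩
    refine le_of_eq_of_le (congrArg (c * ·) (creation_succ q u v L R' eL eR)) (le_of_le_of_eq ?_
      (congrArg _ ((hdr (L, R', eL, eR)).trans (congrArg₂ (fun x y => -(q * c) * x + y)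
        (drift_succ_difference q (φ u v) hL hR') (congrArg₂ (fun x y => q * x + 8 * C * q ^ 2 * y)
          hD1 hD2))).symm))
    have k1 := le_drift_succ hq.le hq1 u v (α u v) (β u v) (M := C * q) (fun _ _ _ => hb _ _ _ _ _)
      (fun _ _ _ => hb _ _ _ _ _) L R' eL eR |>.trans_eq hD1
    have k2 := le_drift_succ hq.le hq1 u v (γ u) (δ v) (M := C * q) (fun _ _ _ => hb _ _ _ _ _)
      (fun _ _ _ => hb _ _ _ _ _) L R' eL eR |>.trans_eq hD2
    have i1 := hd _ (c1 u v ((eL : ℕ) - (eR : ℕ))) _ _ _ hL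
    have i2 := hd _ (c2 u v ((eL : ℕ) - (eR : ℕ))) _ _ _ hR'
    have i3 := hd _ c3 _ _ _ hL
    have i4 := hd _ c3 _ _ _ hR'
    have e0 : ((eL : ℕ) = 0 ∨ (eR : ℕ) = 0) := by
      rcases h0 with h0 | h0
      · exact Or.inl (by simp [h0])
      · exact Or.inr (by simp [h0])
    have Te := hT u v (by omega) (by omega) ((eL : ℕ) - (eR : ℕ)) (by omega) (by omega)
    -- As one of `eL`, `eR` is zero, they are the positive and negative parts of their difference.
    rw [leftRate, rightRate, show ((eL : ℕ) - (eR : ℕ) : ℤ).toNat = eL by omega,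
      show (-((eL : ℕ) - (eR : ℕ) : ℤ)).toNat = eR by omega] at Te
    have f1 := hφd u v ((eL : ℕ) - (eR : ℕ)) (by omega)
    have f2 := hφd u v ((eL : ℕ) - (eR : ℕ) - 1) (by omega)
    rw [sub_add_cancel] at f2
    have iR : (if eR = 0 then (0 : ℝ) else 1) = if ((eL : ℕ) : ℤ) - (eR : ℕ) < 0 then 1 else 0 := by
      have : eR = 0 ↔ ¬ ((eL : ℕ) : ℤ) - (eR : ℕ) < 0 := by
        rw [Fin.ext_iff, Fin.val_zero]
        omega
      simp only [this, ite_not]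
    have iL : (if eL = 0 then (0 : ℝ) else 1) =
        1 - if ((eL : ℕ) : ℤ) - (eR : ℕ) - 1 < 0 then 1 else 0 := by
      have : eL = 0 ↔ ((eL : ℕ) : ℤ) - (eR : ℕ) - 1 < 0 := by
        rw [Fin.ext_iff, Fin.val_zero]
        omega
      simp only [← this]
      split_ifs <;> simp
    have lamK : R (u + eL) eL ≤ K := hR.anti _ _ _ _ (Nat.zero_le _) (Nat.zero_le _)
    have muK : R eR (v + eR) ≤ K := hR.anti _ _ _ _ (Nat.zero_le _) (Nat.zero_le _)
    have gL0 := creation_nonneg hq.le hq1 (u + eL) eL L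
    have gR0 := creation_nonneg hq.le hq1 eR (v + eR) R'
    rw [iR, iL]
    generalize (if ((eL : ℕ) : ℤ) - (eR : ℕ) < 0 then (1 : ℝ) else 0) = jR at *
    generalize (if ((eL : ℕ) : ℤ) - (eR : ℕ) - 1 < 0 then (1 : ℝ) else 0) = jL at *
    generalize φ u v ((eL : ℕ) - (eR : ℕ) + 1) = φp at *
    generalize φ u v ((eL : ℕ) - (eR : ℕ) - 1) = φm at *
    generalize φ u v ((eL : ℕ) - (eR : ℕ)) = φ0 at *
    generalize creation q (u + eL) eL L = gL at *
    generalize creation q eR (v + eR) R' = gR at *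
    generalize R (u + eL) eL = lam at *
    generalize R eR (v + eR) = mu at *
    change drift q (u + eL) eL (h _ (c1 u v ((eL : ℕ) - (eR : ℕ))) (u + eL) eL) L +
      drift q eR (v + eR) (h _ (c2 u v ((eL : ℕ) - (eR : ℕ))) eR (v + eR)) R' - _ ≤ _ at k1
    change drift q (u + eL) eL (h _ c3 (u + eL) eL) L +
      drift q eR (v + eR) (h _ c3 eR (v + eR)) R' - _ ≤ _ at k2
    generalize drift q (u + eL) eL (h _ (c1 u v ((eL : ℕ) - (eR : ℕ))) (u + eL) eL) L = DL at *
    generalize drift q eR (v + eR) (h _ (c2 u v ((eL : ℕ) - (eR : ℕ))) eR (v + eR)) R' = DR at *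
    generalize drift q (u + eL) eL (h _ c3 (u + eL) eL) L = DL' at *
    generalize drift q eR (v + eR) (h _ c3 eR (v + eR)) R' = DR' at *
    generalize ψ u v ((eL : ℕ) - (eR : ℕ)) = ψ0 at *
    generalize ψ u v ((eL : ℕ) - (eR : ℕ) - 1) = ψm at *
    have hQ : 0 < q ^ n := pow_pos hq n
    rw [pow_succ] at i1 i2 i3 i4
    rw [pow_succ (n := n + 1), pow_succ]
    generalize q ^ n = Q at *
    have l2 : (gL + gR) - 8 * C * q * (gL + gR) / 2 - (2 * K + 2 * C) * Q ≤ D2 := by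
      have a1 := mul_le_mul_of_nonneg_left lamK hQ.le
      have a2 := mul_le_mul_of_nonneg_left muK hQ.le
      have a3 : C * (Q * q) ≤ C * Q := by
        refine mul_le_mul_of_nonneg_left ?_ hC.le
        exact mul_le_of_le_one_right hQ.le hq1
      linarith
    -- An a priori bound: up to a drift, the total creation rate of the halves is of order `q ^ n`.
    have l3 : (gL + gR) / 2 - (2 * K + 2 * C) * Q ≤ D2 := by
      have := mul_le_mul_of_nonneg_right hqC (add_nonneg gL0 gR0)
      linarith
    have l4 := mul_le_mul_of_nonneg_left l3 (by positivity : 0 ≤ 8 * C * q ^ 2)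
    have l5 := mul_le_mul_of_nonneg_left k1 hq.le
    have l6 := mul_le_mul_of_nonneg_left (add_le_add i1 i2) hq.le
    have e1 : φp - φ0 = ψ0 - jR := f1
    have e2 : φm - φ0 = (1 - ψm) - (1 - jL) := by linarith
    rw [e1, e2, ← Te]
    have p0 : 0 ≤ ((2 * B + 1) + 2 * C + 16 * C ^ 2) * (Q * q * q) := by positivity
    linarith

theorem hasRate_zero {B : ℕ} : HasRate B 0 (fun u v => if u < B ∧ v < B then 1 else 0) := by
  refine ⟨1, one_pos, 1, one_pos, fun q hq _ _ c _ => ⟨fun _ _ _ => 0, fun _ _ _ => ?_,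
    fun u v s _ => ?_⟩⟩
  · simpa using hq.le
  · rw [creation, drift, eventSum_zero, eventSum_zero]
    simp [hq.le]

/-- Level zero has the exact rate `1` whenever both ends are free, so any start with `0 < f₀ ≤ 1` is
dominated; this covers both initial values of the recursion. -/
theorem exists_rates (B : ℕ) {f₀ : ℕ → ℝ} (h0 : ∀ b, 1 ≤ b → 0 < f₀ b)
    (h1 : ∀ b, 1 ≤ b → f₀ b ≤ 1) (n : ℕ) :
    (∀ b, 1 ≤ b → 0 < rateCoeff f₀ n b) ∧
      ∃ R, IsRateTable B (rateCoeff f₀ n) R ∧ HasRate B n R := by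
  induction n with
  | zero =>
    refine ⟨h0, _, ⟨fun u v hu hv => ?_, fun u v h => ?_, fun u v u' v' hu hv => ?_,
      fun b hb hbB => ?_⟩, hasRate_zero⟩
    · simp [hu, hv]
    · exact if_neg (by omega)
    · split_ifs
      · rfl
      · omega
      · exact zero_le_one
      · rfl
    · rw [if_pos (by omega)]
      exact h1 b hb
  | succ n ih =>
    obtain ⟨hf, R, hR, hRn⟩ := ih
    obtain ⟨T, ψ, hT, hψ, he⟩ := hR.exists_next hf
    exact ⟨fun b hb => coeffStep_pos hf hb, T, hT, HasRate.succ hR hRn hψ he⟩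

/-! ### Mean ergodic theorem for finite Markov semigroups -/

section MeanErgodic

attribute [local instance] Matrix.linftyOpNormedRing Matrix.linftyOpNormedAlgebra

variable {S : Type*} [Fintype S]

/-- Evaluation of a matrix at a vector and a coordinate. -/
noncomputable def Matrix.evalCLM (F : S → ℝ) (s : S) : Matrix S S ℝ →L[ℝ] ℝ :=
  LinearMap.toContinuousLinearMap
    { toFun := fun N => (N.mulVec F) s
      map_add' := fun N N' => by rw [Matrix.add_mulVec, Pi.add_apply]
      map_smul' := fun c N => by rw [Matrix.smul_mulVec, Pi.smul_apply]; rfl }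

theorem Matrix.evalCLM_apply (F : S → ℝ) (s : S) (N : Matrix S S ℝ) :
    Matrix.evalCLM F s N = (N.mulVec F) s := rfl

variable [DecidableEq S]

theorem Matrix.exp_mulVec_nonneg_of_mulVec_nonneg {A : Set S} {M : Matrix S S ℝ}
    (hM : ∀ F : S → ℝ, (∀ s ∈ A, 0 ≤ F s) → ∀ s ∈ A, 0 ≤ (M.mulVec F) s)
    {F : S → ℝ} (hF : ∀ s ∈ A, 0 ≤ F s) {s : S} (hs : s ∈ A) :
    0 ≤ ((NormedSpace.exp M).mulVec F) s := by
  have hpow : ∀ k : ℕ, ∀ s ∈ A, 0 ≤ ((M ^ k).mulVec F) s := by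
    intro k
    induction k with
    | zero => simpa using hF
    | succ k ih =>
      rw [pow_succ', ← Matrix.mulVec_mulVec]
      exact hM _ ih
  have := (NormedSpace.exp_series_hasSum_exp' (𝕂 := ℝ) M).mapL (Matrix.evalCLM F s)
  refine this.nonneg fun k => ?_
  rw [map_smul, smul_eq_mul, Matrix.evalCLM_apply]
  exact mul_nonneg (by positivity) (hpow k s hs)

/-- The semigroup generated by `Q` preserves nonnegativity on `A` if `Q + c` does. -/
theorem Matrix.exp_smul_mulVec_nonneg {A : Set S} {Q : Matrix S S ℝ} {c : ℝ}
    (hQ : ∀ F : S → ℝ, (∀ s ∈ A, 0 ≤ F s) → ∀ s ∈ A, 0 ≤ (Q.mulVec F) s + c * F s)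
    {F : S → ℝ} (hF : ∀ s ∈ A, 0 ≤ F s) {t : ℝ} (ht : 0 ≤ t) {s : S} (hs : s ∈ A) :
    0 ≤ ((NormedSpace.exp (t • Q)).mulVec F) s := by
  -- Shifting by a scalar matrix only contributes a positive factor `exp (-(t * c))`, and the power
  -- series of the rest preserves nonnegativity on `A`.
  have e : t • Q = Matrix.diagonal (fun _ => -(t * c)) + t • (Q + Matrix.diagonal fun _ => c) := by
    ext i j
    simp only [Matrix.smul_apply, Matrix.add_apply, Matrix.diagonal_apply, smul_eq_mul]
    split_ifs <;> ring
  have hc : Commute (Matrix.diagonal (fun _ : S => -(t * c)))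
      (t • (Q + Matrix.diagonal fun _ => c)) := by
    rw [← Matrix.smul_one_eq_diagonal]
    exact (Commute.one_left _).smul_left _
  rw [e, Matrix.exp_add_of_commute _ _ hc, Matrix.exp_diagonal, ← Matrix.mulVec_mulVec,
    Matrix.mulVec_diagonal, Pi.coe_exp, ← Real.exp_eq_exp_ℝ]
  refine mul_nonneg (Real.exp_pos _).le (Matrix.exp_mulVec_nonneg_of_mulVec_nonneg ?_ hF hs)
  intro G hG s hs
  rw [Matrix.smul_mulVec, Matrix.add_mulVec, Pi.smul_apply, Pi.add_apply, Matrix.mulVec_diagonal]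
  exact mul_nonneg ht (hQ G hG s hs)

theorem Matrix.hasDerivAt_exp_smul_mulVec (Q : Matrix S S ℝ) (F : S → ℝ) (s : S) (t : ℝ) :
    HasDerivAt (fun t : ℝ => ((NormedSpace.exp (t • Q)).mulVec F) s)
      (((NormedSpace.exp (t • Q)).mulVec (Q.mulVec F)) s) t := by
  have := (Matrix.evalCLM F s).hasFDerivAt.comp_hasDerivAt t (hasDerivAt_exp_smul_const Q t)
  rw [Matrix.mulVec_mulVec]
  exact this

theorem Matrix.continuous_exp_smul_mulVec (Q : Matrix S S ℝ) (F : S → ℝ) (s : S) :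
    Continuous (fun t : ℝ => ((NormedSpace.exp (t • Q)).mulVec F) s) :=
  continuous_iff_continuousAt.2 fun t => (Matrix.hasDerivAt_exp_smul_mulVec Q F s t).continuousAt

theorem Matrix.integral_exp_smul_mulVec (Q : Matrix S S ℝ) (F : S → ℝ) (s : S) (t : ℝ) :
    ∫ τ in (0 : ℝ)..t, ((NormedSpace.exp (τ • Q)).mulVec (Q.mulVec F)) s =
      ((NormedSpace.exp (t • Q)).mulVec F) s - F s := by
  rw [intervalIntegral.integral_eq_sub_of_hasDerivAt
    (fun τ _ => Matrix.hasDerivAt_exp_smul_mulVec Q F s τ)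
    ((Matrix.continuous_exp_smul_mulVec Q _ s).intervalIntegrable _ _)]
  simp

theorem Matrix.exp_smul_mulVec_of_mulVec_eq_zero {Q : Matrix S S ℝ} {k : S → ℝ}
    (hk : Q.mulVec k = 0) (t : ℝ) : (NormedSpace.exp (t • Q)).mulVec k = k := by
  funext s
  have := Matrix.integral_exp_smul_mulVec Q k s t
  rw [hk] at this
  simp only [Matrix.mulVec_zero, Pi.zero_apply, intervalIntegral.integral_zero] at this
  linarith

variable {Q : Matrix S S ℝ} {c : ℝ}

/-- The semigroup generated by a matrix with nonnegative off-diagonal entries and zero row sums is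
bounded. -/
theorem Matrix.abs_exp_smul_mulVec_le (h1 : Q.mulVec (fun _ => 1) = 0)
    (hQ : ∀ F : S → ℝ, (∀ s, 0 ≤ F s) → ∀ s, 0 ≤ (Q.mulVec F) s + c * F s)
    {F : S → ℝ} {M : ℝ} (hF : ∀ s, |F s| ≤ M) {t : ℝ} (ht : 0 ≤ t) (s : S) :
    |((NormedSpace.exp (t • Q)).mulVec F) s| ≤ M := by
  have hM : (NormedSpace.exp (t • Q)).mulVec (fun _ => M) = fun _ => M := by
    refine Matrix.exp_smul_mulVec_of_mulVec_eq_zero ?_ t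
    have : (fun _ : S => M) = M • fun _ => 1 := by
      funext; simp
    rw [this, Matrix.mulVec_smul, h1, smul_zero]
  have pos : ∀ G : S → ℝ, (∀ s, 0 ≤ G s) → 0 ≤ ((NormedSpace.exp (t • Q)).mulVec G) s :=
    fun G hG => Matrix.exp_smul_mulVec_nonneg (A := Set.univ) (c := c)
      (fun F hF s _ => hQ F (fun s => hF s trivial) s) (fun s _ => hG s) ht trivial
  have p1 := pos ((fun _ => M) - F) fun s => by
    have := (abs_le.1 (hF s)).2
    simpa using this
  have p2 := pos ((fun _ => M) + F) fun s => by
    have := (abs_le.1 (hF s)).1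
    simp only [Pi.add_apply]
    linarith
  rw [Matrix.mulVec_sub, hM, Pi.sub_apply] at p1
  rw [Matrix.mulVec_add, hM, Pi.add_apply] at p2
  exact abs_le.2 ⟨by linarith, by linarith⟩

theorem Matrix.tendsto_exp_smul_mulVec_div (h1 : Q.mulVec (fun _ => 1) = 0)
    (hQ : ∀ F : S → ℝ, (∀ s, 0 ≤ F s) → ∀ s, 0 ≤ (Q.mulVec F) s + c * F s)
    (F : S → ℝ) (s : S) :
    Tendsto (fun t : ℝ => (((NormedSpace.exp (t • Q)).mulVec F) s - F s) / t) atTop (𝓝 0) := by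
  have hF : ∀ s, |F s| ≤ ∑ s, |F s| := fun s =>
    Finset.single_le_sum (f := fun s => |F s|) (fun _ _ => abs_nonneg _) (Finset.mem_univ s)
  have lim : Tendsto (fun t : ℝ => (2 * ∑ s, |F s|) / t) atTop (𝓝 0) :=
    tendsto_const_nhds.div_atTop tendsto_id
  refine squeeze_zero_norm' ?_ lim
  filter_upwards [eventually_gt_atTop 0] with t ht
  rw [Real.norm_eq_abs, abs_div, abs_of_pos ht]
  refine div_le_div_of_nonneg_right ?_ ht.le
  have a1 := Matrix.abs_exp_smul_mulVec_le h1 hQ hF ht.le s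
  have a2 := hF s
  exact (abs_sub _ _).trans (by linarith)

/-- The mean ergodic theorem for finite continuous-time Markov chains. -/
theorem Matrix.exists_tendsto_average (h1 : Q.mulVec (fun _ => 1) = 0)
    (hQ : ∀ F : S → ℝ, (∀ s, 0 ≤ F s) → ∀ s, 0 ≤ (Q.mulVec F) s + c * F s)
    (g : S → ℝ) (s : S) :
    ∃ E : ℝ, Tendsto (fun t : ℝ => (∫ τ in (0 : ℝ)..t, ((NormedSpace.exp (τ • Q)).mulVec g) s) / t)
      atTop (𝓝 E) := by
  -- For `k = Q h` in the kernel, the time average of the semigroup applied to `k` is constantly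
  -- `k`, yet equals `(exp (t Q) h - h) / t`, which tends to `0`. By dimension, range and kernel
  -- then span everything.
  have hdisj : Disjoint (LinearMap.range Q.mulVecLin) (LinearMap.ker Q.mulVecLin) := by
    rw [Submodule.disjoint_def]
    rintro k ⟨h, hh⟩ hk
    rw [Matrix.mulVecLin_apply] at hh
    rw [LinearMap.mem_ker, Matrix.mulVecLin_apply] at hk
    funext x
    have lim := Matrix.tendsto_exp_smul_mulVec_div h1 hQ h x
    refine tendsto_nhds_unique (Tendsto.congr' ?_ tendsto_const_nhds) lim
    filter_upwards [eventually_gt_atTop 0] with t ht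
    rw [← Matrix.integral_exp_smul_mulVec, hh]
    simp only [Matrix.exp_smul_mulVec_of_mulVec_eq_zero hk, intervalIntegral.integral_const,
      sub_zero, smul_eq_mul]
    field_simp
  have htop := Submodule.eq_top_of_disjoint _ _ (LinearMap.finrank_range_add_finrank_ker _).ge hdisj
  have hg : g ∈ LinearMap.range Q.mulVecLin ⊔ LinearMap.ker Q.mulVecLin := htop ▸ Submodule.mem_top
  obtain ⟨_, ⟨h, rfl⟩, k, hk, rfl⟩ := Submodule.mem_sup.1 hg
  rw [LinearMap.mem_ker, Matrix.mulVecLin_apply] at hk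
  refine ⟨0 + k s, Tendsto.congr' ?_
    ((Matrix.tendsto_exp_smul_mulVec_div h1 hQ h s).add tendsto_const_nhds)⟩
  filter_upwards [eventually_gt_atTop 0] with t ht
  simp only [Matrix.mulVecLin_apply, Matrix.mulVec_add, Pi.add_apply,
    Matrix.exp_smul_mulVec_of_mulVec_eq_zero hk]
  rw [intervalIntegral.integral_add
    ((Matrix.continuous_exp_smul_mulVec Q _ s).intervalIntegrable _ _) (by simp),
    Matrix.integral_exp_smul_mulVec]
  simp only [intervalIntegral.integral_const, sub_zero, smul_eq_mul]
  field_simp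

/-- A one-sided approximate solution of the Poisson equation on a closed set of states bounds the
long-run average. -/
theorem Matrix.average_le {A : Set S} (h1 : Q.mulVec (fun _ => 1) = 0)
    (hQ : ∀ F : S → ℝ, (∀ s, 0 ≤ F s) → ∀ s, 0 ≤ (Q.mulVec F) s + c * F s)
    (hA : ∀ F : S → ℝ, (∀ s ∈ A, 0 ≤ F s) → ∀ s ∈ A, 0 ≤ (Q.mulVec F) s + c * F s)
    {g h : S → ℝ} {r σ E : ℝ} (hg : ∀ s ∈ A, σ * g s ≤ r + (Q.mulVec h) s) {s : S} (hs : s ∈ A)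
    (hE : Tendsto (fun t : ℝ => (∫ τ in (0 : ℝ)..t, ((NormedSpace.exp (τ • Q)).mulVec g) s) / t)
      atTop (𝓝 E)) : σ * E ≤ r := by
  refine le_of_tendsto_of_tendsto (hE.const_mul σ)
    (by simpa using tendsto_const_nhds.add (Matrix.tendsto_exp_smul_mulVec_div h1 hQ h s) :
      Tendsto (fun t : ℝ => r + (((NormedSpace.exp (t • Q)).mulVec h) s - h s) / t) atTop (𝓝 r)) ?_
  filter_upwards [eventually_gt_atTop 0] with t ht
  have hr : Q.mulVec (fun _ => r) = 0 := by
    have : (fun _ : S => r) = r • fun _ => 1 := by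
      funext; simp
    rw [this, Matrix.mulVec_smul, h1, smul_zero]
  have key : ∀ τ : ℝ, 0 ≤ τ → σ * ((NormedSpace.exp (τ • Q)).mulVec g) s ≤
      r + ((NormedSpace.exp (τ • Q)).mulVec (Q.mulVec h)) s := fun τ hτ => by
    have := Matrix.exp_smul_mulVec_nonneg hA (F := ((fun _ => r) + Q.mulVec h) - σ • g)
      (fun s hs => by
        have := hg s hs
        simp only [Pi.sub_apply, Pi.add_apply, Pi.smul_apply, smul_eq_mul]
        linarith) hτ hs
    rw [Matrix.mulVec_sub, Matrix.mulVec_add, Matrix.mulVec_smul,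
      Matrix.exp_smul_mulVec_of_mulVec_eq_zero hr] at this
    simp only [Pi.sub_apply, Pi.add_apply, Pi.smul_apply, smul_eq_mul] at this
    linarith
  have mono := intervalIntegral.integral_mono_on ht.le
    (((Matrix.continuous_exp_smul_mulVec Q g s).const_mul σ).intervalIntegrable
      (μ := MeasureTheory.volume) 0 t)
    ((continuous_const.add (Matrix.continuous_exp_smul_mulVec Q (Q.mulVec h) s)).intervalIntegrable
      0 t) fun τ hτ => key τ hτ.1
  simp only [Pi.add_apply] at mono
  rw [intervalIntegral.integral_const_mul, intervalIntegral.integral_add (by simp)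
    ((Matrix.continuous_exp_smul_mulVec Q _ s).intervalIntegrable _ _),
    Matrix.integral_exp_smul_mulVec] at mono
  simp only [intervalIntegral.integral_const, sub_zero, smul_eq_mul] at mono
  rw [← mul_div_assoc, div_le_iff₀ ht, add_mul, div_mul_cancel₀ _ ht.ne']
  linarith

end MeanErgodic

/-! ### Application to the repeater chain -/

theorem cognitiveGenerator_mulVec (p q : ℝ) (B n : ℕ) (F : ChainState B n → ℝ)
    (s : ChainState B n) :
    ((cognitiveGenerator p q B n).mulVec F) s = p * drift q 0 0 F s := by
  simp only [Matrix.mulVec, dotProduct, cognitiveGenerator, Matrix.of_apply, drift, eventSum,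
    mul_assoc p, ← Finset.mul_sum, Finset.sum_mul]
  congr 1
  rw [Finset.sum_comm]
  refine Finset.sum_congr rfl fun l _ => ?_
  rw [Finset.sum_comm]
  refine Finset.sum_congr rfl fun coin _ => ?_
  simp only [mul_assoc, ← Finset.mul_sum, sub_mul, ite_mul, one_mul, zero_mul,
    Finset.sum_sub_distrib, Finset.sum_ite_eq, Finset.mem_univ, if_true]

theorem deliveryIntensity_eq (p q : ℝ) (B n : ℕ) (s : ChainState B n) :
    deliveryIntensity p q B n s = p * creation q 0 0 s := rfl

theorem cognitiveGenerator_mulVec_one (p q : ℝ) (B n : ℕ) :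
    (cognitiveGenerator p q B n).mulVec (fun _ => 1) = 0 := by
  funext s
  rw [cognitiveGenerator_mulVec]
  simp [drift, eventSum_const]

theorem cognitiveGenerator_mulVec_add (p q : ℝ) (B n : ℕ) (F : ChainState B n → ℝ)
    (s : ChainState B n) :
    ((cognitiveGenerator p q B n).mulVec F) s + p * 2 ^ n * F s =
      p * eventSum q 0 0 (fun s' _ => F s') s := by
  have : drift q 0 0 F s = eventSum q 0 0 (fun s' _ => F s') s + -1 * (2 ^ n * F s) := by
    rw [← eventSum_const q 0 0 (F s) s, ← eventSum_const_mul, ← eventSum_add, drift]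
    simp only [sub_eq_add_neg, neg_mul, one_mul]
  rw [cognitiveGenerator_mulVec, this]
  ring

theorem cognitiveGenerator_pos {p q : ℝ} (hp : 0 < p) (h0 : 0 ≤ q) (h1 : q ≤ 1) (B n : ℕ)
    (F : ChainState B n → ℝ) (hF : ∀ s, 0 ≤ F s) (s : ChainState B n) :
    0 ≤ ((cognitiveGenerator p q B n).mulVec F) s + p * 2 ^ n * F s := by
  rw [cognitiveGenerator_mulVec_add]
  exact mul_nonneg hp.le (Finset.sum_nonneg fun _ _ => Finset.sum_nonneg fun _ _ =>
    mul_nonneg (coinProb_nonneg h0 h1 _) (hF _))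

theorem exists_isDistributionRate {p q : ℝ} (hp : 0 < p) (h0 : 0 ≤ q) (h1 : q ≤ 1) (B n : ℕ) :
    ∃ E, IsDistributionRate p q B n E :=
  Matrix.exists_tendsto_average (cognitiveGenerator_mulVec_one p q B n)
    (cognitiveGenerator_pos hp h0 h1 B n) (deliveryIntensity p q B n) (ChainState.empty B n)

theorem IsDistributionRate.mul_le {p q : ℝ} (hp : 0 < p) (h0 : 0 ≤ q) (h1 : q ≤ 1) {B n : ℕ}
    {E : ℝ} (hE : IsDistributionRate p q B n E) {c r : ℝ} {h : ChainState B n → ℝ}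
    (hg : ∀ s, s.Admissible n 0 0 → c * creation q 0 0 s ≤ r + drift q 0 0 h s) :
    c * E ≤ p * r := by
  refine Matrix.average_le (A := {s | s.Admissible n 0 0}) (g := deliveryIntensity p q B n) (h := h)
    (cognitiveGenerator_mulVec_one p q B n)
    (cognitiveGenerator_pos hp h0 h1 B n) (fun F hF s hs => ?_) (fun s hs => ?_)
    (ChainState.admissible_empty B n) hE
  · rw [cognitiveGenerator_mulVec_add]
    exact mul_nonneg hp.le (eventSum_nonneg h0 h1 hs fun s' _ hs' => hF s' hs')
  · rw [cognitiveGenerator_mulVec, deliveryIntensity_eq]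
    have := mul_le_mul_of_nonneg_left (hg s hs) hp.le
    linarith

theorem HasRate.tendsto {B n : ℕ} {R : ℕ → ℕ → ℝ} (hR : HasRate B n R) {p : ℝ} (hp : 0 < p)
    {E : ℝ → ℝ} (hE : ∀ q : ℝ, 0 < q → q ≤ 1 → IsDistributionRate p q B n (E q))
    {f : ℝ} (hf : 0 < f) :
    Tendsto (fun q : ℝ => E q / (p * q ^ n * f)) (𝓝[>] 0) (𝓝 (R 0 0 / f)) := by
  obtain ⟨C, hC, q₀, hq₀, H⟩ := hR
  have lim : Tendsto (fun q : ℝ => C * q / f) (𝓝[>] 0) (𝓝 0) := by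
    have : Tendsto (fun q : ℝ => C * q / f) (𝓝 0) (𝓝 (C * 0 / f)) :=
      Continuous.tendsto (by fun_prop) 0
    rw [mul_zero, zero_div] at this
    exact this.mono_left nhdsWithin_le_nhds
  rw [tendsto_iff_norm_sub_tendsto_zero]
  refine squeeze_zero' (Eventually.of_forall fun _ => norm_nonneg _) ?_ lim
  filter_upwards [Ioc_mem_nhdsGT (lt_min hq₀ one_pos)] with q hq
  obtain ⟨hq, hqm⟩ := hq
  have hq1 := hqm.trans (min_le_right _ _)
  -- The choices `c = 1` and `c = -1` give the upper and lower bounds, with relative error of order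
  -- `q`.
  have bound : ∀ c : ℝ, |c| ≤ 1 → c * E q ≤ p * (c * (q ^ n * R 0 0) + C * q ^ (n + 1)) := by
    intro c hc
    obtain ⟨h, -, hd⟩ := H q hq (hqm.trans (min_le_left _ _)) hq1 c hc
    exact (hE q hq hq1).mul_le hp hq.le hq1 (h := h 0 0) fun s hs => hd 0 0 s hs
  have u1 := bound 1 (by simp)
  have u2 := bound (-1) (by simp)
  have hQ : 0 < q ^ n := pow_pos hq n
  have hpos : 0 < p * q ^ n * f := by positivity
  have e : E q / (p * q ^ n * f) - R 0 0 / f = (E q - p * (q ^ n * R 0 0)) / (p * q ^ n * f) := by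
    field_simp
  rw [e, Real.norm_eq_abs, abs_div, abs_of_pos hpos, div_le_iff₀ hpos]
  have e2 : C * q / f * (p * q ^ n * f) = p * (C * q ^ (n + 1)) := by
    field_simp
    ring
  rw [e2, abs_le]
  constructor <;> linarith

theorem exists_limit_ge_one {p : ℝ} (hp : 0 < p) {B n : ℕ} (hB : 1 ≤ B) {f₀ : ℕ → ℝ}
    (h0 : ∀ b, 1 ≤ b → 0 < f₀ b) (h1 : ∀ b, 1 ≤ b → f₀ b ≤ 1)
    {E : ℝ → ℝ} (hE : ∀ q : ℝ, 0 < q → q ≤ 1 → IsDistributionRate p q B n (E q)) :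
    ∃ c : ℝ, 1 ≤ c ∧
      Tendsto (fun q : ℝ => E q / (p * q ^ n * rateCoeff f₀ n B)) (𝓝[>] 0) (𝓝 c) := by
  obtain ⟨hf, R, hR, hRn⟩ := exists_rates B h0 h1 n
  refine ⟨_, ?_, hRn.tendsto hp hE (hf B hB)⟩
  rw [one_le_div (hf B hB)]
  simpa using hR.le B hB le_rfl

theorem rateCoeff_one_one (n : ℕ) : rateCoeff (fun _ => 1) n 1 = (2 / 3) ^ n := by
  induction n with
  | zero => rfl
  | succ n ih =>
    simp only [rateCoeff, Finset.sum_range_one, zero_add, Finset.prod_range_one, Nat.sub_zero,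
      pow_one]
    rw [ih, div_self (by positivity), pow_succ]
    norm_num

theorem theorem2 (p : ℝ) (hp : 0 < p) (B : ℕ) (hB : 1 ≤ B) (i : ℕ) :
    (∃ E : ℝ → ℝ,
      (∀ q : ℝ, 0 < q → q ≤ 1 → IsDistributionRate p q B i (E q)) ∧
      (∃ c : ℝ, 1 ≤ c ∧
        Tendsto (fun q : ℝ => E q / (p * q ^ i * rateCoeff (fun _ => 1) i B)) (𝓝[>] 0) (𝓝 c)) ∧
      (∃ c : ℝ, 1 ≤ c ∧
        Tendsto (fun q : ℝ => E q /
          (p * q ^ i * rateCoeff (fun b => 2 * (b : ℝ) / (2 * (b : ℝ) + 1)) i B))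
          (𝓝[>] 0) (𝓝 c))) ∧
    (∀ q : ℝ, p * q ^ i * rateCoeff (fun _ => 1) i 1 = p * (2 * q / 3) ^ i) := by
  have hex : ∀ q : ℝ, ∃ E, 0 < q → q ≤ 1 → IsDistributionRate p q B i E := fun q => by
    by_cases h : 0 < q ∧ q ≤ 1
    · obtain ⟨E, hE⟩ := exists_isDistributionRate hp h.1.le h.2 B i
      exact ⟨E, fun _ _ => hE⟩
    · exact ⟨0, fun h0 h1 => absurd ⟨h0, h1⟩ h⟩
  choose E hE using hex
  refine ⟨⟨E, hE, exists_limit_ge_one hp hB (fun _ _ => one_pos) (fun _ _ => le_rfl) hE,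
    exists_limit_ge_one hp hB (fun b hb => ?_) (fun b hb => ?_) hE⟩, fun q => ?_⟩
  · have : (0 : ℝ) < b := by exact_mod_cast hb
    positivity
  · exact div_le_one_of_le₀ (by linarith) (by positivity)
  · rw [rateCoeff_one_one, mul_assoc, ← mul_pow]
    congr 2
    ring
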